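/- Let $k$ be a field of characteristic $0$, with the discrete topology. Let $L$ be the lattice of finite subgroups of $\mathbb{Q}/\mathbb{Z}$, ordered by inclusion, and let $[X,Y]\sim[U,V]$ if $Y/X\cong V/U$. Let $R=\mathbf{R}(L,\sim)$ be the reduced incidence algebra over $k$, i.e. the functions from the set of $\sim$-classes of intervals of $L$ to $k$, with the convolution product $(fg)([X,Y])=\sum_{X\le Z\le Y}f([X,Z])\,g([Z,Y])$ and the topology of pointwise convergence; this is the algebra of formal Dirichlet series $\sum_{n\ge1}f(n)n^{-s}$, where $n$ is the order of $Y/X$. Regard $k$ as an $R$-bimodule through the augmentation $\varepsilon\colon f\mapsto f([0,0])$ (the coefficient of $n=1$). Let $HH^*_{\rm cts}(R,k)$ be the continuous Hochschild cohomology with these trivial coefficients: the cohomology of the complex of continuous $k$-multilinear maps $R^n\to k$ with the Hochschild differential $$(df)(a_0,\dots,a_n)=\varepsilon(a_0)f(a_1,\dots,a_n)+\sum_{j=0}^{n-1}(-1)^{j+1}f(a_0,\dots,a_ja_{j+1},\dots,a_n)+(-1)^{n+1}f(a_0,\dots,a_{n-1})\varepsilon(a_n),$$ graded by $n$, with the cup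 product $(f\cup g)(a_1,\dots,a_{p+q})=f(a_1,\dots,a_p)\,g(a_{p+1},\dots,a_{p+q})$. Then the graded $k$-algebra $HH^*_{\rm cts}(R,k)$ is graded commutative, $xy=(-1)^{pq}yx$ for $x\in HH^p_{\rm cts}(R,k)$ and $y\in HH^q_{\rm cts}(R,k)$, and it has countably many generators: there are classes $X_i\in HH^1_{\rm cts}(R,k)$, $i\in\mathbb{N}$, which generate it as a $k$-algebra, and there is an isomorphism of graded $k$-algebras from $HH^*_{\rm cts}(R,k)$ onto the exterior algebra $\Lambda^*\big(k^{(\mathbb{N})}\big)$ (the free graded commutative algebra on countably infinitely many generators of degree $1$) taking $X_i$ to the $i$-th basis vector. -/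

import Mathlib

/-! ### Reduced incidence algebras -/

namespace RedInc

section General

variable (k : Type*) [Field k] {P : Type*} [PartialOrder P] [LocallyFiniteOrder P]

/-- A function in the incidence algebra which is constant on the classes of intervals. -/
def IsInvariant {k : Type*} [Field k] {P : Type*} [PartialOrder P]
    (r : Setoid (NonemptyInterval P)) (f : IncidenceAlgebra k P) : Prop :=
  ∀ s t : NonemptyInterval P, r s t → f s.fst s.snd = f t.fst t.snd

/-- An equivalence relation on intervals is order compatible if the functions in the incidence
algebra which are constant on classes are closed under multiplication. -/
def OrderCompatible (r : Setoid (NonemptyInterval P)) : Prop :=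
  ∀ f g : IncidenceAlgebra k P, IsInvariant r f → IsInvariant r g → IsInvariant r (f * g)

variable {k}

theorem isInvariant_one [DecidableEq P] [CharZero k] {r : Setoid (NonemptyInterval P)}
    (h : OrderCompatible k r) : IsInvariant r (1 : IncidenceAlgebra k P) := by
  classical
  intro s t hst
  have hz : IsInvariant r (IncidenceAlgebra.zeta k : IncidenceAlgebra k P) := by
    intro s t _
    rw [IncidenceAlgebra.zeta_of_le s.fst_le_snd, IncidenceAlgebra.zeta_of_le t.fst_le_snd]
  have h1 := h _ _ hz hz s t hst
  have key : ∀ u : NonemptyInterval P,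
      (IncidenceAlgebra.zeta k * IncidenceAlgebra.zeta k : IncidenceAlgebra k P) u.fst u.snd
        = ((Finset.Icc u.fst u.snd).card : k) := by
    intro u
    rw [IncidenceAlgebra.zeta_mul_zeta]
  rw [key, key, Nat.cast_inj] at h1
  have key2 : ∀ u : NonemptyInterval P,
      u.fst = u.snd ↔ (Finset.Icc u.fst u.snd).card = 1 := by
    intro u
    rw [Finset.card_eq_one]
    constructor
    · intro e
      exact ⟨u.fst, by rw [← e, Finset.Icc_self]⟩
    · rintro ⟨a, ha⟩
      have h1 : u.fst ∈ Finset.Icc u.fst u.snd := Finset.left_mem_Icc.2 u.fst_le_snd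
      have h2 : u.snd ∈ Finset.Icc u.fst u.snd := Finset.right_mem_Icc.2 u.fst_le_snd
      rw [ha, Finset.mem_singleton] at h1 h2
      rw [h1, h2]
  simp only [IncidenceAlgebra.one_apply, key2, h1]

/-- The reduced incidence algebra `R(P, ∼)`: the functions on the set of types of intervals,
multiplied as elements of the incidence algebra. -/
def reducedIncidenceAlgebra (k : Type*) [Field k] [CharZero k] {P : Type*} [PartialOrder P]
    [LocallyFiniteOrder P] [DecidableEq P] (r : Setoid (NonemptyInterval P))
    (h : OrderCompatible k r) : Subalgebra k (IncidenceAlgebra k P) where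
  carrier := {f | IsInvariant r f}
  mul_mem' hf hg := h _ _ hf hg
  add_mem' hf hg s t hst := by
    rw [IncidenceAlgebra.add_apply, IncidenceAlgebra.add_apply, hf s t hst, hg s t hst]
  algebraMap_mem' c s t hst := by
    rw [Algebra.algebraMap_eq_smul_one, IncidenceAlgebra.constSMul_apply,
      IncidenceAlgebra.constSMul_apply, isInvariant_one h s t hst]

end General

section Topology

variable {k : Type*} [TopologicalSpace k] {P : Type*} [PartialOrder P]

/-- The standard topology of the incidence algebra: pointwise convergence. -/
instance topologicalSpace [Zero k] : TopologicalSpace (IncidenceAlgebra k P) :=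
  TopologicalSpace.induced (fun f (x : P) (y : P) => f x y) inferInstance

theorem continuous_apply [Zero k] (x y : P) :
    Continuous fun f : IncidenceAlgebra k P => f x y :=
  (_root_.continuous_apply y).comp ((_root_.continuous_apply x).comp continuous_induced_dom)

instance isTopologicalSemiring [Field k] [IsTopologicalRing k] [LocallyFiniteOrder P]
    [DecidableEq P] : IsTopologicalSemiring (IncidenceAlgebra k P) where
  continuous_add := by
    refine continuous_induced_rng.2 (continuous_pi fun x => continuous_pi fun y => ?_)
    exact ((continuous_apply x y).comp continuous_fst).add
      ((continuous_apply x y).comp continuous_snd)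
  continuous_mul := by
    refine continuous_induced_rng.2 (continuous_pi fun x => continuous_pi fun y => ?_)
    simp only [Function.comp_def, IncidenceAlgebra.mul_apply]
    exact continuous_finsetSum _ fun z _ => ((continuous_apply x z).comp continuous_fst).mul
      ((continuous_apply z y).comp continuous_snd)

end Topology

section Augmentation

variable (k : Type*) [Field k] [CharZero k] [TopologicalSpace k] [IsTopologicalRing k]
  {P : Type*} [PartialOrder P] [LocallyFiniteOrder P] [DecidableEq P]

/-- Evaluation at a one-point interval `[x, x]`, as a continuous character of the reduced
incidence algebra. -/
def evalPoint (r : Setoid (NonemptyInterval P)) (h : OrderCompatible k r) (x : P) :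
    reducedIncidenceAlgebra k r h →A[k] k where
  toFun f := (f : IncidenceAlgebra k P) x x
  map_one' := by simp
  map_mul' f g := by simp
  map_zero' := by simp
  map_add' f g := by simp [IncidenceAlgebra.add_apply]
  commutes' c := by
    simp [Algebra.algebraMap_eq_smul_one]
  cont := (continuous_apply x x).comp continuous_subtype_val

end Augmentation

end RedInc

/-! ### The lattice of finite subgroups of `ℚ/ℤ` -/

namespace Dirichlet

/-- The finite subgroups of the group of rational numbers modulo `1`, ordered by inclusion. -/
def FinSubgroup : Type := {H : AddSubgroup (AddCircle (1 : ℚ)) // Finite H}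

noncomputable instance : PartialOrder FinSubgroup :=
  inferInstanceAs (PartialOrder {H : AddSubgroup (AddCircle (1 : ℚ)) // Finite H})

noncomputable instance : DecidableEq FinSubgroup := Classical.decEq _

noncomputable instance : LocallyFiniteOrder FinSubgroup :=
  LocallyFiniteOrder.ofFiniteIcc fun x y => by
    have hy : (y.1 : Set (AddCircle (1 : ℚ))).Finite := y.2
    have hinj : Function.Injective
        (fun z : FinSubgroup => (z.1 : Set (AddCircle (1 : ℚ)))) :=
      SetLike.coe_injective.comp Subtype.val_injective
    exact (hy.finite_subsets.preimage hinj.injOn).subset fun z hz => hz.2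

/-- The trivial subgroup. -/
def trivialSubgroup : FinSubgroup := ⟨⊥, inferInstance⟩

end Dirichlet

namespace Dirichlet

section Quotients

variable {G : Type*} [AddCommGroup G]

/-- The image in `K` of a subgroup `Z` of `Y`. -/
def toQuot {K : Type*} [AddCommGroup K] {Y : AddSubgroup G} (π : Y →+ K) (Z : AddSubgroup G) :
    AddSubgroup K := (Z.addSubgroupOf Y).map π

/-- The subgroup of `Y` which is the preimage of a subgroup of `K`. -/
def ofQuot {K : Type*} [AddCommGroup K] {Y : AddSubgroup G} (π : Y →+ K) (T : AddSubgroup K) :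
    AddSubgroup G := (T.comap π).map Y.subtype

variable {K : Type*} [AddCommGroup K] {X Y Z : AddSubgroup G} (π : Y →+ K)

theorem mem_ofQuot {T : AddSubgroup K} {g : G} :
    g ∈ ofQuot π T ↔ ∃ h : g ∈ Y, π ⟨g, h⟩ ∈ T := by
  simp [ofQuot]

theorem mem_toQuot (hker : π.ker = X.addSubgroupOf Y) (hXZ : X ≤ Z) (y : Y) :
    π y ∈ toQuot π Z ↔ (y : G) ∈ Z := by
  constructor
  · rintro ⟨z, hz, hzy⟩
    have : y - z ∈ π.ker := by simp [AddMonoidHom.mem_ker, hzy]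
    rw [hker, AddSubgroup.mem_addSubgroupOf] at this
    have h2 := Z.add_mem (hXZ this) (AddSubgroup.mem_addSubgroupOf.1 hz)
    simpa using h2
  · intro hy
    exact ⟨y, AddSubgroup.mem_addSubgroupOf.2 hy, rfl⟩

theorem toQuot_ofQuot (hπ : Function.Surjective π) (T : AddSubgroup K) :
    toQuot π (ofQuot π T) = T := by
  ext t
  constructor
  · rintro ⟨y, hy, rfl⟩
    obtain ⟨_, h⟩ := (mem_ofQuot π).1 (AddSubgroup.mem_addSubgroupOf.1 hy)
    exact h
  · intro ht
    obtain ⟨y, rfl⟩ := hπ t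
    exact ⟨y, AddSubgroup.mem_addSubgroupOf.2 ((mem_ofQuot π).2 ⟨y.2, ht⟩), rfl⟩

theorem ofQuot_toQuot (hker : π.ker = X.addSubgroupOf Y) (hXZ : X ≤ Z) (hZY : Z ≤ Y) :
    ofQuot π (toQuot π Z) = Z := by
  ext g
  rw [mem_ofQuot]
  constructor
  · rintro ⟨h, hg⟩
    exact (mem_toQuot π hker hXZ ⟨g, h⟩).1 hg
  · intro hg
    exact ⟨hZY hg, (mem_toQuot π hker hXZ ⟨g, hZY hg⟩).2 hg⟩

theorem ofQuot_le (T : AddSubgroup K) : ofQuot π T ≤ Y := fun _ hg => ((mem_ofQuot π).1 hg).1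

theorem le_ofQuot (hker : π.ker = X.addSubgroupOf Y) (hXY : X ≤ Y) (T : AddSubgroup K) :
    X ≤ ofQuot π T := by
  intro g hg
  refine (mem_ofQuot π).2 ⟨hXY hg, ?_⟩
  have : (⟨g, hXY hg⟩ : Y) ∈ π.ker := by rw [hker]; exact AddSubgroup.mem_addSubgroupOf.2 hg
  rw [AddMonoidHom.mem_ker] at this
  rw [this]
  exact T.zero_mem

theorem nonempty_lower (hker : π.ker = X.addSubgroupOf Y) (hZY : Z ≤ Y) :
    Nonempty ((Z ⧸ X.addSubgroupOf Z) ≃+ toQuot π Z) := by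
  let ψ : Z →+ toQuot π Z :=
    (π.comp (AddSubgroup.inclusion hZY)).codRestrict (toQuot π Z) fun z =>
      ⟨AddSubgroup.inclusion hZY z, AddSubgroup.mem_addSubgroupOf.2 z.2, rfl⟩
  have hψ : Function.Surjective ψ := by
    rintro ⟨t, y, hy, rfl⟩
    exact ⟨⟨y, AddSubgroup.mem_addSubgroupOf.1 hy⟩, Subtype.ext rfl⟩
  have hk : X.addSubgroupOf Z = ψ.ker := by
    ext z
    have h1 : AddSubgroup.inclusion hZY z ∈ π.ker ↔ (z : G) ∈ X := by
      rw [hker]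
      rfl
    rw [AddSubgroup.mem_addSubgroupOf, ← h1, AddMonoidHom.mem_ker, AddMonoidHom.mem_ker]
    exact (Subtype.ext_iff (a1 := ψ z) (a2 := 0)).symm
  exact ⟨(QuotientAddGroup.quotientAddEquivOfEq hk).trans
    (QuotientAddGroup.quotientKerEquivOfSurjective ψ hψ)⟩

theorem nonempty_upper (hπ : Function.Surjective π) (hker : π.ker = X.addSubgroupOf Y)
    (hXZ : X ≤ Z) : Nonempty ((Y ⧸ Z.addSubgroupOf Y) ≃+ (K ⧸ toQuot π Z)) := by
  let ψ : Y →+ K ⧸ toQuot π Z := (QuotientAddGroup.mk' (toQuot π Z)).comp π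
  have hψ : Function.Surjective ψ := (QuotientAddGroup.mk'_surjective _).comp hπ
  have hk : Z.addSubgroupOf Y = ψ.ker := by
    ext y
    rw [AddSubgroup.mem_addSubgroupOf, AddMonoidHom.mem_ker, ← mem_toQuot π hker hXZ y]
    exact (QuotientAddGroup.eq_zero_iff (N := toQuot π Z) (π y)).symm
  exact ⟨(QuotientAddGroup.quotientAddEquivOfEq hk).trans
    (QuotientAddGroup.quotientKerEquivOfSurjective ψ hψ)⟩

end Quotients

/-- Two intervals `[X, Y]` and `[U, V]` of finite subgroups are equivalent if the groups `Y/X` and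
`V/U` are isomorphic. -/
def quotientSetoid : Setoid (NonemptyInterval FinSubgroup) where
  r s t := Nonempty
    ((s.snd.1 ⧸ s.fst.1.addSubgroupOf s.snd.1) ≃+ (t.snd.1 ⧸ t.fst.1.addSubgroupOf t.snd.1))
  iseqv :=
    { refl := fun _ => ⟨AddEquiv.refl _⟩
      symm := fun ⟨e⟩ => ⟨e.symm⟩
      trans := fun ⟨e⟩ ⟨e'⟩ => ⟨e.trans e'⟩ }

/-- Given surjections from `Y` and `V` to `K` with kernels `X` and `U`, the subgroup between `U`
and `V` with the same image in `K` as `Z`. -/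
def transport {K : Type*} [AddCommGroup K] {Y V : FinSubgroup} (π : Y.1 →+ K) (ρ : V.1 →+ K)
    (Z : FinSubgroup) : FinSubgroup :=
  ⟨ofQuot ρ (toQuot π Z.1), by
    have := V.2
    exact Finite.of_injective _ (AddSubgroup.inclusion_injective (ofQuot_le ρ (toQuot π Z.1)))⟩

theorem transport_transport {K : Type*} [AddCommGroup K] {X Y V Z : FinSubgroup}
    (π : Y.1 →+ K) (ρ : V.1 →+ K) (hρ : Function.Surjective ρ)
    (hker : π.ker = X.1.addSubgroupOf Y.1) (hXZ : X ≤ Z) (hZY : Z ≤ Y) :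
    transport ρ π (transport π ρ Z) = Z := by
  apply Subtype.ext
  change ofQuot π (toQuot ρ (ofQuot ρ (toQuot π Z.1))) = Z.1
  rw [toQuot_ofQuot ρ hρ, ofQuot_toQuot π hker hXZ hZY]

theorem orderCompatible_quotientSetoid (k : Type*) [Field k] :
    RedInc.OrderCompatible k quotientSetoid := by
  intro f g hf hg s t hst
  obtain ⟨e⟩ := hst
  let ρ : t.snd.1 →+ (t.snd.1 ⧸ t.fst.1.addSubgroupOf t.snd.1) := QuotientAddGroup.mk' _
  let π : s.snd.1 →+ (t.snd.1 ⧸ t.fst.1.addSubgroupOf t.snd.1) :=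
    e.toAddMonoidHom.comp (QuotientAddGroup.mk' _)
  have hρ : Function.Surjective ρ := QuotientAddGroup.mk'_surjective _
  have hπ : Function.Surjective π := e.surjective.comp (QuotientAddGroup.mk'_surjective _)
  have kρ : ρ.ker = t.fst.1.addSubgroupOf t.snd.1 := QuotientAddGroup.ker_mk' _
  have kπ : π.ker = s.fst.1.addSubgroupOf s.snd.1 := by
    ext y
    rw [AddMonoidHom.mem_ker]
    change e (QuotientAddGroup.mk' _ y) = 0 ↔ _
    rw [AddEquiv.map_eq_zero_iff]
    exact QuotientAddGroup.eq_zero_iff y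
  rw [IncidenceAlgebra.mul_apply, IncidenceAlgebra.mul_apply]
  have mem1 : ∀ Z, transport π ρ Z ∈ Finset.Icc t.fst t.snd := fun Z =>
    Finset.mem_Icc.2 ⟨le_ofQuot ρ kρ t.fst_le_snd _, ofQuot_le ρ _⟩
  have mem2 : ∀ Z, transport ρ π Z ∈ Finset.Icc s.fst s.snd := fun Z =>
    Finset.mem_Icc.2 ⟨le_ofQuot π kπ s.fst_le_snd _, ofQuot_le π _⟩
  refine Finset.sum_bij' (fun Z _ => transport π ρ Z) (fun W _ => transport ρ π W)
    (fun Z _ => mem1 Z) (fun W _ => mem2 W) ?_ ?_ ?_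
  · intro Z hZ
    rw [Finset.mem_Icc] at hZ
    exact transport_transport π ρ hρ kπ hZ.1 hZ.2
  · intro W hW
    rw [Finset.mem_Icc] at hW
    exact transport_transport ρ π hπ kρ hW.1 hW.2
  · intro Z hZ
    rw [Finset.mem_Icc] at hZ
    have hW := Finset.mem_Icc.1 (mem1 Z)
    have hT : toQuot ρ (transport π ρ Z).1 = toQuot π Z.1 := toQuot_ofQuot ρ hρ _
    obtain ⟨a⟩ := nonempty_lower π kπ hZ.2
    obtain ⟨b⟩ := nonempty_lower ρ kρ hW.2
    obtain ⟨c⟩ := nonempty_upper π hπ kπ hZ.1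
    obtain ⟨d⟩ := nonempty_upper ρ hρ kρ hW.1
    rw [hT] at b d
    congr 1
    · exact hf ⟨(s.fst, Z), hZ.1⟩ ⟨(t.fst, _), hW.1⟩ ⟨a.trans b.symm⟩
    · exact hg ⟨(Z, s.snd), hZ.2⟩ ⟨(_, t.snd), hW.2⟩ ⟨c.trans d.symm⟩

/-- The reduced incidence algebra of the lattice of finite subgroups of `ℚ/ℤ`: the algebra of
formal Dirichlet series. -/
noncomputable abbrev dirichletAlgebra (k : Type*) [Field k] [CharZero k] :
    Subalgebra k (IncidenceAlgebra k FinSubgroup) :=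
  RedInc.reducedIncidenceAlgebra k quotientSetoid (orderCompatible_quotientSetoid k)

/-- The augmentation, taking a function on types to its value on the type of the one-point
intervals (the coefficient of `1` of a formal Dirichlet series). -/
noncomputable def augmentation (k : Type*) [Field k] [CharZero k] [TopologicalSpace k] [IsTopologicalRing k] :
    dirichletAlgebra k →A[k] k :=
  RedInc.evalPoint k quotientSetoid (orderCompatible_quotientSetoid k) trivialSubgroup

end Dirichlet

/-! ### Continuous Hochschild cohomology with trivial coefficients -/

namespace ContHochschild

section Cochains

set_option linter.unusedSectionVars false


/-- Continuous Hochschild `n`-cochains of `A` with values in `k`. -/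
def Cochain (k A : Type*) [Field k] [TopologicalSpace k] [Ring A] [Algebra k A]
    [TopologicalSpace A] (n : ℕ) : Type _ :=
  ContinuousMultilinearMap k (fun _ : Fin n => A) k

section CochainInstances

variable {k A : Type*} [Field k] [TopologicalSpace k] [Ring A] [Algebra k A] [TopologicalSpace A]
  {n : ℕ}

instance : FunLike (Cochain k A n) (Fin n → A) k :=
  inferInstanceAs (FunLike (ContinuousMultilinearMap k (fun _ : Fin n => A) k) _ _)

instance [IsTopologicalRing k] : AddCommGroup (Cochain k A n) :=
  inferInstanceAs (AddCommGroup (ContinuousMultilinearMap k (fun _ : Fin n => A) k))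

instance [IsTopologicalRing k] : Module k (Cochain k A n) :=
  inferInstanceAs (Module k (ContinuousMultilinearMap k (fun _ : Fin n => A) k))

@[ext]
theorem Cochain.ext {f g : Cochain k A n} (h : ∀ a, f a = g a) : f = g := DFunLike.ext f g h

@[simp]
theorem Cochain.zero_apply [IsTopologicalRing k] (a : Fin n → A) : (0 : Cochain k A n) a = 0 := rfl

@[simp]
theorem Cochain.add_apply [IsTopologicalRing k] (f g : Cochain k A n) (a : Fin n → A) :
    (f + g) a = f a + g a := rfl

@[simp]
theorem Cochain.smul_apply [IsTopologicalRing k] (c : k) (f : Cochain k A n) (a : Fin n → A) :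
    (c • f) a = c * f a := rfl

@[simp]
theorem Cochain.sum_apply [IsTopologicalRing k] {ι : Type*} (s : Finset ι)
    (f : ι → Cochain k A n) (a : Fin n → A) : (∑ i ∈ s, f i) a = ∑ i ∈ s, f i a :=
  map_sum (⟨⟨fun f : Cochain k A n => f a, rfl⟩, fun _ _ => rfl⟩ : Cochain k A n →+ k) f s

theorem Cochain.map_update_add (f : Cochain k A n) (a : Fin n → A) (i : Fin n) (x y : A) :
    f (Function.update a i (x + y)) = f (Function.update a i x) + f (Function.update a i y) :=
  ContinuousMultilinearMap.map_update_add f a i x y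

theorem Cochain.map_update_smul (f : Cochain k A n) (a : Fin n → A) (i : Fin n) (c : k) (x : A) :
    f (Function.update a i (c • x)) = c * f (Function.update a i x) :=
  ContinuousMultilinearMap.map_update_smul f a i c x

theorem Cochain.cont (f : Cochain k A n) : Continuous f := ContinuousMultilinearMap.cont f

/-- A continuous multilinear form, regarded as a cochain. -/
def Cochain.ofMap (f : ContinuousMultilinearMap k (fun _ : Fin n => A) k) : Cochain k A n := f

end CochainInstances

theorem contractNth_update {k A : Type*} [Field k] [Ring A] [Algebra k A] {n : ℕ} (j : Fin n) (a : Fin (n + 1) → A) (m : Fin (n + 1)) :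
    ∃ (i : Fin n) (φ : A →ₗ[k] A), ∀ x,
      Fin.contractNth j.castSucc (· * ·) (Function.update a m x) =
        Function.update (Fin.contractNth j.castSucc (· * ·) a) i (φ x) := by
  rcases lt_trichotomy (m : ℕ) j with h | h | h
  · refine ⟨⟨m, by omega⟩, LinearMap.id, fun x => ?_⟩
    ext i
    simp only [Fin.contractNth, Function.update_apply, Fin.ext_iff, Fin.val_castSucc,
      Fin.val_succ, LinearMap.id_apply]
    split_ifs <;> first | rfl | omega
  · refine ⟨⟨m, by omega⟩, LinearMap.mulRight k (a j.succ), fun x => ?_⟩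
    ext i
    simp only [Fin.contractNth, Function.update_apply, Fin.ext_iff, Fin.val_castSucc,
      Fin.val_succ, LinearMap.mulRight_apply]
    split_ifs <;> first | rfl | omega | skip
    have : i = j := by ext; omega
    rw [this]
  · refine ⟨⟨m - 1, by omega⟩, if (m : ℕ) = j + 1 then LinearMap.mulLeft k (a j.castSucc)
      else LinearMap.id, fun x => ?_⟩
    ext i
    simp only [Fin.contractNth, Function.update_apply, Fin.ext_iff, Fin.val_castSucc,
      Fin.val_succ]
    split_ifs <;> first | rfl | omega | skip
    have : i = j := by ext; omega
    rw [this]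
    rfl

variable {k A : Type*} [Field k] [TopologicalSpace k] [IsTopologicalRing k]
  [Ring A] [Algebra k A] [TopologicalSpace A] [ContinuousMul A]

/-- The cochain `(a₀, …, aₙ) ↦ f (a₀, …, aⱼ aⱼ₊₁, …, aₙ)`. -/
def mulAt {n : ℕ} (f : Cochain k A n) (j : Fin n) : Cochain k A (n + 1) :=
  Cochain.ofMap {
  toFun a := f (Fin.contractNth j.castSucc (· * ·) a)
  map_update_add' {inst} a m x y := by
    obtain rfl : inst = instDecidableEqFin (n + 1) := Subsingleton.elim _ _
    obtain ⟨i, φ, h⟩ := contractNth_update (k := k) j a m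
    rw [h, h, h, map_add, f.map_update_add]
  map_update_smul' {inst} a m c x := by
    obtain rfl : inst = instDecidableEqFin (n + 1) := Subsingleton.elim _ _
    obtain ⟨i, φ, h⟩ := contractNth_update (k := k) j a m
    rw [h, h, map_smul, f.map_update_smul, smul_eq_mul]
  cont := by
    refine f.cont.comp (continuous_pi fun i => ?_)
    simp only [Fin.contractNth]
    split_ifs <;> fun_prop }

/-- The cochain `(a₀, …, aₙ) ↦ ε(a₀) f (a₁, …, aₙ)`. -/
def headMul (ε : A →A[k] k) {n : ℕ} (f : Cochain k A n) : Cochain k A (n + 1) :=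
  Cochain.ofMap {
  toFun a := ε (a 0) * f (Fin.tail a)
  map_update_add' {inst} a m x y := by
    obtain rfl : inst = instDecidableEqFin (n + 1) := Subsingleton.elim _ _
    refine Fin.cases ?_ (fun i => ?_) m
    · simp [add_mul]
    · simp [mul_add, (Fin.succ_ne_zero i).symm, f.map_update_add]
  map_update_smul' {inst} a m c x := by
    obtain rfl : inst = instDecidableEqFin (n + 1) := Subsingleton.elim _ _
    refine Fin.cases ?_ (fun i => ?_) m
    · simp [mul_assoc]
    · simp [(Fin.succ_ne_zero i).symm, mul_left_comm, f.map_update_smul]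
  cont := by
    refine (ε.cont.comp (continuous_apply 0)).mul (f.cont.comp (continuous_pi fun i => ?_))
    exact continuous_apply i.succ }

/-- The cochain `(a₀, …, aₙ) ↦ f (a₀, …, aₙ₋₁) ε(aₙ)`. -/
def lastMul (ε : A →A[k] k) {n : ℕ} (f : Cochain k A n) : Cochain k A (n + 1) :=
  Cochain.ofMap {
  toFun a := f (Fin.init a) * ε (a (Fin.last n))
  map_update_add' {inst} a m x y := by
    obtain rfl : inst = instDecidableEqFin (n + 1) := Subsingleton.elim _ _
    refine Fin.lastCases ?_ (fun i => ?_) m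
    · simp [mul_add]
    · simp [add_mul, (Fin.castSucc_lt_last i).ne', f.map_update_add]
  map_update_smul' {inst} a m c x := by
    obtain rfl : inst = instDecidableEqFin (n + 1) := Subsingleton.elim _ _
    refine Fin.lastCases ?_ (fun i => ?_) m
    · simp [mul_left_comm]
    · simp [(Fin.castSucc_lt_last i).ne', mul_assoc, f.map_update_smul]
  cont := by
    refine (f.cont.comp (continuous_pi fun i => ?_)).mul (ε.cont.comp (continuous_apply _))
    exact continuous_apply i.castSucc }

theorem mulAt_apply {n : ℕ} (f : Cochain k A n) (j : Fin n) (a : Fin (n + 1) → A) :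
    mulAt f j a = f (Fin.contractNth j.castSucc (· * ·) a) := rfl

theorem headMul_apply (ε : A →A[k] k) {n : ℕ} (f : Cochain k A n) (a : Fin (n + 1) → A) :
    headMul ε f a = ε (a 0) * f (Fin.tail a) := rfl

theorem lastMul_apply (ε : A →A[k] k) {n : ℕ} (f : Cochain k A n) (a : Fin (n + 1) → A) :
    lastMul ε f a = f (Fin.init a) * ε (a (Fin.last n)) := rfl

/-- The Hochschild differential with coefficients in the bimodule `k`, on which `A` acts from both
sides through `ε`. -/
def d (ε : A →A[k] k) (n : ℕ) : Cochain k A n →ₗ[k] Cochain k A (n + 1) where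
  toFun f := headMul ε f + ∑ j : Fin n, (-1 : k) ^ ((j : ℕ) + 1) • mulAt f j
    + (-1 : k) ^ (n + 1) • lastMul ε f
  map_add' f g := by
    ext a
    simp only [Cochain.add_apply, Cochain.sum_apply,
      Cochain.smul_apply, headMul_apply, mulAt_apply, lastMul_apply,
      mul_add, add_mul, Finset.sum_add_distrib]
    ring
  map_smul' c f := by
    ext a
    simp only [Cochain.add_apply, Cochain.sum_apply,
      Cochain.smul_apply, headMul_apply, mulAt_apply, lastMul_apply,
      mul_add, Finset.mul_sum, RingHom.id_apply]
    congr 1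
    · congr 1
      · ring
      · exact Finset.sum_congr rfl fun _ _ => by ring
    · ring

theorem d_apply (ε : A →A[k] k) {n : ℕ} (f : Cochain k A n) (a : Fin (n + 1) → A) :
    d ε n f a = ε (a 0) * f (Fin.tail a)
      + ∑ j : Fin n, (-1 : k) ^ ((j : ℕ) + 1) * f (Fin.contractNth j.castSucc (· * ·) a)
      + (-1 : k) ^ (n + 1) * (f (Fin.init a) * ε (a (Fin.last n))) := by
  simp [d, headMul_apply, mulAt_apply, lastMul_apply]

theorem update_castAdd {p q : ℕ} (a : Fin (p + q) → A) (m : Fin p) (x : A) :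
    (fun i => Function.update a (Fin.castAdd q m) x (Fin.castAdd q i)) =
        Function.update (fun i => a (Fin.castAdd q i)) m x ∧
      (fun i => Function.update a (Fin.castAdd q m) x (Fin.natAdd p i)) =
        fun i => a (Fin.natAdd p i) := by
  constructor
  · ext i
    simp [Function.update_apply]
  · ext i
    rw [Function.update_of_ne]
    intro h
    have := congrArg Fin.val h
    simp at this
    omega

theorem update_natAdd {p q : ℕ} (a : Fin (p + q) → A) (m : Fin q) (x : A) :
    (fun i => Function.update a (Fin.natAdd p m) x (Fin.castAdd q i)) =
        (fun i => a (Fin.castAdd q i)) ∧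
      (fun i => Function.update a (Fin.natAdd p m) x (Fin.natAdd p i)) =
        Function.update (fun i => a (Fin.natAdd p i)) m x := by
  constructor
  · ext i
    rw [Function.update_of_ne]
    intro h
    have := congrArg Fin.val h
    simp at this
    omega
  · ext i
    simp [Function.update_apply]

/-- The cup product `(f ∪ g) (a₁, …, aₚ₊ₙ) = f (a₁, …, aₚ) g (aₚ₊₁, …, aₚ₊ₙ)`. -/
def cup {p q : ℕ} (f : Cochain k A p) (g : Cochain k A q) : Cochain k A (p + q) :=
  Cochain.ofMap {
  toFun a := f (fun i => a (Fin.castAdd q i)) * g (fun i => a (Fin.natAdd p i))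
  map_update_add' {inst} a m x y := by
    obtain rfl : inst = instDecidableEqFin (p + q) := Subsingleton.elim _ _
    refine Fin.addCases (fun i => ?_) (fun i => ?_) m
    · simp only [update_castAdd, f.map_update_add, add_mul]
    · simp only [update_natAdd, g.map_update_add, mul_add]
  map_update_smul' {inst} a m c x := by
    obtain rfl : inst = instDecidableEqFin (p + q) := Subsingleton.elim _ _
    refine Fin.addCases (fun i => ?_) (fun i => ?_) m
    · simp only [update_castAdd, f.map_update_smul, smul_eq_mul, mul_assoc]
    · simp only [update_natAdd, g.map_update_smul, smul_eq_mul, mul_left_comm]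
  cont := by
    refine (f.cont.comp (continuous_pi fun i => ?_)).mul (g.cont.comp (continuous_pi fun i => ?_))
    · exact continuous_apply _
    · exact continuous_apply _ }

theorem cup_apply {p q : ℕ} (f : Cochain k A p) (g : Cochain k A q) (a : Fin (p + q) → A) :
    cup f g a = f (fun i => a (Fin.castAdd q i)) * g (fun i => a (Fin.natAdd p i)) := rfl

/-- The Leibniz rule, evaluated on elements. -/
theorem d_cup_apply (ε : A →A[k] k) {p q : ℕ} (f : Cochain k A p) (g : Cochain k A q)
    (a : Fin (p + q + 1) → A) :
    d ε (p + q) (cup f g) a =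
      d ε p f (fun i => a (Fin.castLE (by omega) i)) * g (fun i => a ⟨p + 1 + i, by omega⟩)
      + (-1 : k) ^ p * (f (fun i => a (Fin.castLE (by omega) i)) *
          d ε q g (fun i => a ⟨p + i, by omega⟩)) := by
  have e1 : ∀ j : Fin p, cup f g (Fin.contractNth (Fin.castAdd q j).castSucc (· * ·) a) =
      f (Fin.contractNth j.castSucc (· * ·) fun i : Fin (p + 1) => a (Fin.castLE (by omega) i)) *
        g (fun i => a ⟨p + 1 + i, by omega⟩) := by
    intro j
    rw [cup_apply]
    congr 2
    ext i
    simp only [Fin.contractNth, Fin.val_castSucc, Fin.val_castAdd, Fin.val_natAdd]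
    rw [if_neg (by omega), if_neg (by omega)]
    congr 1
    ext
    simp
    omega
  have e2 : ∀ j : Fin q, cup f g (Fin.contractNth (Fin.natAdd p j).castSucc (· * ·) a) =
      f (fun i => a (Fin.castLE (by omega) i)) *
        g (Fin.contractNth j.castSucc (· * ·) fun i : Fin (q + 1) => a ⟨p + i, by omega⟩) := by
    intro j
    rw [cup_apply]
    congr 2
    · ext i
      simp only [Fin.contractNth, Fin.val_castSucc, Fin.val_castAdd, Fin.val_natAdd]
      rw [if_pos (by omega)]
      rfl
    · ext i
      simp only [Fin.contractNth, Fin.val_castSucc, Fin.val_natAdd, Nat.add_lt_add_iff_left,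
        Nat.add_left_cancel_iff]
      split_ifs <;> rfl
  have e3 : cup f g (Fin.tail a) =
      f (Fin.tail fun i : Fin (p + 1) => a (Fin.castLE (by omega) i)) *
        g (fun i => a ⟨p + 1 + i, by omega⟩) := by
    rw [cup_apply]
    congr 2
    ext i
    simp only [Fin.tail]
    congr 1
    ext
    simp
    omega
  have e4 : cup f g (Fin.init a) = f (fun i => a (Fin.castLE (by omega) i)) *
        g (Fin.init fun i : Fin (q + 1) => a ⟨p + i, by omega⟩) := rfl
  have e5 : Fin.init (fun i : Fin (p + 1) => a (Fin.castLE (by omega) i)) =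
      (fun i => a (Fin.castLE (by omega) i)) := rfl
  have e6 : Fin.tail (fun i : Fin (q + 1) => a ⟨p + i, by omega⟩) =
      (fun i : Fin q => a ⟨p + 1 + i, by omega⟩) := by
    ext i
    simp only [Fin.tail]
    congr 1
    ext
    simp
    omega
  rw [d_apply, d_apply, d_apply, Fin.sum_univ_add]
  simp only [e1, e2, e3, e4, e5, e6]
  have e7 : (⟨p + ((0 : Fin (q + 1)) : ℕ), by omega⟩ : Fin (p + q + 1)) =
      Fin.castLE (by omega) (Fin.last p) := rfl
  have e8 : (⟨p + ((Fin.last q : Fin (q + 1)) : ℕ), by omega⟩ : Fin (p + q + 1)) =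
      Fin.last (p + q) := rfl
  have e9 : Fin.castLE (by omega) (0 : Fin (p + 1)) = (0 : Fin (p + q + 1)) := rfl
  rw [e7, e8, e9]
  simp only [Fin.val_castAdd, Fin.val_natAdd, add_mul, mul_add, Finset.sum_mul, Finset.mul_sum]
  have s1 : ∀ (F : k) (u : Fin q → k) , ∑ j : Fin q, (-1 : k) ^ (p + (j : ℕ) + 1) * (F * u j) =
      ∑ j : Fin q, (-1 : k) ^ p * (F * ((-1 : k) ^ ((j : ℕ) + 1) * u j)) :=
    fun F u => Finset.sum_congr rfl fun j _ => by ring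
  have s2 : ∀ (F : k) (u : Fin p → k) , ∑ j : Fin p, (-1 : k) ^ ((j : ℕ) + 1) * (u j * F) =
      ∑ j : Fin p, (-1 : k) ^ ((j : ℕ) + 1) * u j * F :=
    fun F u => Finset.sum_congr rfl fun j _ => by ring
  rw [s1, s2]
  ring

/-- The `i`-th face of a tuple, `0 ≤ i ≤ n + 1`. -/
def faceTuple {n : ℕ} (i : ℕ) (a : Fin (n + 1) → A) (m : Fin n) : A :=
  if (m : ℕ) + 1 < i then a m.castSucc else
    if (m : ℕ) + 1 = i then a m.castSucc * a m.succ else a m.succ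

/-- The scalar attached to the `i`-th face of a tuple. -/
def faceScalar (ε : A →A[k] k) {n : ℕ} (i : ℕ) (a : Fin (n + 1) → A) : k :=
  (if i = 0 then ε (a 0) else 1) * (if i = n + 1 then ε (a (Fin.last n)) else 1)

theorem d_apply_faces (ε : A →A[k] k) {n : ℕ} (f : Cochain k A n) (a : Fin (n + 1) → A) :
    d ε n f a =
      ∑ i : Fin (n + 2), (-1 : k) ^ (i : ℕ) * (faceScalar ε i a * f (faceTuple i a)) := by
  rw [d_apply, Fin.sum_univ_succ, Fin.sum_univ_castSucc]
  have h0 : faceTuple 0 a = Fin.tail a := by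
    ext m
    simp [faceTuple, Fin.tail]
  have h1 : faceTuple (n + 1) a = Fin.init a := by
    ext m
    simp [faceTuple, Fin.init]
  have h2 : ∀ j : Fin n, faceTuple ((j : ℕ) + 1) a = Fin.contractNth j.castSucc (· * ·) a := by
    intro j
    ext m
    simp [faceTuple, Fin.contractNth]
  have h3 : ∀ j : Fin n, faceScalar ε ((j : ℕ) + 1) a = 1 := by
    intro j
    simp [faceScalar, j.2.ne]
  have h4 : faceScalar ε 0 a = ε (a 0) := by simp [faceScalar]
  have h5 : faceScalar ε (n + 1) a = ε (a (Fin.last n)) := by simp [faceScalar]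
  simp only [Fin.val_zero, Fin.val_succ, Fin.val_castSucc, Fin.val_last, h0, h1, h2, h3, h4, h5]
  simp only [one_mul, pow_zero]
  ring

theorem faceTuple_faceTuple {n : ℕ} {i j : ℕ} (hij : i ≤ j) (a : Fin (n + 2) → A) :
    faceTuple i (faceTuple (j + 1) a) = faceTuple j (faceTuple i a) := by
  ext m
  simp only [faceTuple, Fin.val_castSucc, Fin.val_succ, Fin.succ_castSucc]
  split_ifs <;> first | rfl | omega | exact mul_assoc _ _ _ | exact (mul_assoc _ _ _).symm

theorem faceScalar_faceScalar (ε : A →A[k] k) {n : ℕ} {i j : ℕ} (hij : i ≤ j) (hj : j ≤ n + 1)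
    (a : Fin (n + 2) → A) :
    faceScalar ε (j + 1) a * faceScalar ε i (faceTuple (j + 1) a) =
      faceScalar ε i a * faceScalar ε j (faceTuple i a) := by
  have e2 : (Fin.last n).succ = Fin.last (n + 1) := rfl
  simp only [faceScalar, faceTuple, Fin.val_zero, Fin.val_last, Fin.castSucc_zero,
    Fin.succ_zero_eq_one, e2]
  by_cases hi : i = 0
  · subst hi
    by_cases hj0 : j = 0
    · subst hj0
      simp
    · by_cases hjn : j = n + 1
      · subst hjn
        simp [mul_comm]
      · have h1 : ¬ j + 1 = n + 1 + 1 := by omega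
        have h2 : ¬ 0 = j := by omega
        have h3 : 0 < j := by omega
        simp [h3, hj0, hjn]
  · have hj0 : ¬ j = 0 := by omega
    by_cases hjn : j = n + 1
    · subst hjn
      by_cases hin : i = n + 1
      · subst hin
        simp [mul_comm]
      · have h1 : ¬ n + 1 < i := by omega
        have h2 : ¬ n + 1 = i := by omega
        have h3 : ¬ i = n + 1 + 1 := by omega
        simp [hi, hin, h1, h2, h3]
    · have h1 : ¬ j + 1 = n + 1 + 1 := by omega
      have h2 : ¬ i = n + 1 := by omega
      have h3 : ¬ i = n + 1 + 1 := by omega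
      simp [hi, hj0, hjn, h2, h3]

theorem sum_sum_eq_zero (N : ℕ) (T : ℕ → ℕ → k)
    (hT : ∀ i j, i ≤ j → j ≤ N → T (j + 1) i = -T i j) :
    ∑ i : Fin (N + 2), ∑ j : Fin (N + 1), T i j = 0 := by
  have h1 : ∀ i : ℕ, ∑ j : Fin (N + 1), T i j = ∑ j ∈ Finset.range (N + 1), T i j := fun i =>
    Fin.sum_univ_eq_sum_range (fun j => T i j) (N + 1)
  simp only [h1]
  rw [Fin.sum_univ_eq_sum_range (fun i => ∑ j ∈ Finset.range (N + 1), T i j) (N + 2),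
    ← Finset.sum_product']
  refine Finset.sum_involution
    (fun x _ => if x.2 < x.1 then (x.2, x.1 - 1) else (x.2 + 1, x.1)) ?_ ?_ ?_ ?_
  · rintro ⟨i, j⟩ hx
    simp only [Finset.mem_product, Finset.mem_range] at hx
    dsimp only
    split_ifs with h
    · obtain ⟨i, rfl⟩ : ∃ i', i = i' + 1 := ⟨i - 1, by omega⟩
      rw [hT j i (by omega) (by omega)]
      simp
    · rw [hT i j (by omega) (by omega)]
      simp
  · rintro ⟨i, j⟩ hx _
    dsimp only
    split_ifs <;> simp only [ne_eq, Prod.mk.injEq] <;> omega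
  · rintro ⟨i, j⟩ hx
    simp only [Finset.mem_product, Finset.mem_range] at hx ⊢
    split_ifs <;> constructor <;> dsimp only <;> omega
  · rintro ⟨i, j⟩ hx
    dsimp only
    split_ifs <;> simp only [Prod.mk.injEq] <;> constructor <;> first | trivial | omega

theorem d_d (ε : A →A[k] k) {n : ℕ} (f : Cochain k A n) : d ε (n + 1) (d ε n f) = 0 := by
  ext a
  rw [d_apply_faces]
  simp only [d_apply_faces, Finset.mul_sum]
  refine sum_sum_eq_zero (n + 1) (fun i j => (-1 : k) ^ i * (faceScalar ε i a *
    ((-1 : k) ^ j * (faceScalar ε j (faceTuple i a) * f (faceTuple j (faceTuple i a)))))) ?_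
  intro i j hij hj
  have h1 := faceTuple_faceTuple hij a
  have h2 := faceScalar_faceScalar ε hij hj a
  rw [h1]
  linear_combination (-1 : k) ^ (j + 1 + i) * f (faceTuple j (faceTuple i a)) * h2

end Cochains

section Cohomology

variable {k A : Type*} [Field k] [TopologicalSpace k] [IsTopologicalRing k]
  [Ring A] [Algebra k A] [TopologicalSpace A] [ContinuousMul A]

/-- Cocycles. -/
def cocycles (ε : A →A[k] k) (n : ℕ) : Submodule k (Cochain k A n) := LinearMap.ker (d ε n)

/-- Coboundaries. -/
def coboundaries (ε : A →A[k] k) : ∀ n : ℕ, Submodule k (Cochain k A n)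
  | 0 => ⊥
  | n + 1 => LinearMap.range (d ε n)

theorem coboundaries_le_cocycles (ε : A →A[k] k) : ∀ n : ℕ, coboundaries ε n ≤ cocycles ε n
  | 0 => bot_le
  | n + 1 => by
    rintro _ ⟨f, rfl⟩
    exact d_d ε f

/-- The continuous Hochschild cohomology `HHⁿ(A, k)` with coefficients in `k`, on which `A` acts
through the augmentation `ε`. -/
def HH (ε : A →A[k] k) (n : ℕ) : Type _ :=
  cocycles ε n ⧸ (coboundaries ε n).submoduleOf (cocycles ε n)

instance (ε : A →A[k] k) (n : ℕ) : AddCommGroup (HH ε n) :=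
  inferInstanceAs (AddCommGroup (cocycles ε n ⧸ (coboundaries ε n).submoduleOf (cocycles ε n)))

instance (ε : A →A[k] k) (n : ℕ) : Module k (HH ε n) :=
  inferInstanceAs (Module k (cocycles ε n ⧸ (coboundaries ε n).submoduleOf (cocycles ε n)))

/-- The class of a cocycle. -/
def cls (ε : A →A[k] k) (n : ℕ) : cocycles ε n →ₗ[k] HH ε n :=
  ((coboundaries ε n).submoduleOf (cocycles ε n)).mkQ

theorem cls_surjective (ε : A →A[k] k) (n : ℕ) : Function.Surjective (cls ε n) :=
  Submodule.mkQ_surjective _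

theorem cls_eq_zero {ε : A →A[k] k} {n : ℕ} (z : cocycles ε n) :
    cls ε n z = 0 ↔ (z : Cochain k A n) ∈ coboundaries ε n :=
  (Submodule.Quotient.mk_eq_zero _).trans Submodule.mem_comap

theorem mem_coboundaries_of_succ {ε : A →A[k] k} {m n : ℕ} (h : m + 1 = n) (f : Cochain k A n)
    (b : Cochain k A m) (H : ∀ a, f a = d ε m b (fun i => a (Fin.cast h i))) :
    f ∈ coboundaries ε n := by
  subst h
  exact ⟨b, Cochain.ext fun a => (H a).symm⟩

theorem cup_mem_cocycles {ε : A →A[k] k} {p q : ℕ} {f : Cochain k A p} {g : Cochain k A q}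
    (hf : f ∈ cocycles ε p) (hg : g ∈ cocycles ε q) : cup f g ∈ cocycles ε (p + q) := by
  refine LinearMap.mem_ker.2 (Cochain.ext fun a => ?_)
  rw [d_cup_apply, LinearMap.mem_ker.1 hf, LinearMap.mem_ker.1 hg]
  simp

theorem cup_mem_coboundaries_left {ε : A →A[k] k} {p q : ℕ} {f : Cochain k A p}
    {g : Cochain k A q} (hf : f ∈ coboundaries ε p) (hg : g ∈ cocycles ε q) :
    cup f g ∈ coboundaries ε (p + q) := by
  cases p with
  | zero =>
    obtain rfl : f = 0 := hf
    convert Submodule.zero_mem _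
    ext a
    rw [cup_apply, Cochain.zero_apply, zero_mul, Cochain.zero_apply]
  | succ p =>
    obtain ⟨b, rfl⟩ := hf
    refine mem_coboundaries_of_succ (m := p + q) (by omega) _ (cup b g) fun a => ?_
    rw [d_cup_apply, LinearMap.mem_ker.1 hg, cup_apply]
    simp
    rfl

theorem cup_mem_coboundaries_right {ε : A →A[k] k} {p q : ℕ} {f : Cochain k A p}
    {g : Cochain k A q} (hf : f ∈ cocycles ε p) (hg : g ∈ coboundaries ε q) :
    cup f g ∈ coboundaries ε (p + q) := by
  cases q with
  | zero =>
    obtain rfl : g = 0 := hg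
    convert Submodule.zero_mem _
    ext a
    rw [cup_apply, Cochain.zero_apply, mul_zero, Cochain.zero_apply]
  | succ q =>
    obtain ⟨b, rfl⟩ := hg
    refine mem_coboundaries_of_succ (m := p + q) rfl _ ((-1 : k) ^ p • cup f b) fun a => ?_
    rw [map_smul, Cochain.smul_apply, d_cup_apply, LinearMap.mem_ker.1 hf, cup_apply]
    simp [← mul_assoc, ← mul_pow]
    rfl

/-- The cup product of cocycles, as a bilinear map. -/
def cupCocycles (ε : A →A[k] k) (p q : ℕ) :
    cocycles ε p →ₗ[k] cocycles ε q →ₗ[k] cocycles ε (p + q) :=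
  LinearMap.mk₂ k (fun f g => ⟨cup f.1 g.1, cup_mem_cocycles f.2 g.2⟩)
    (fun f f' g => Subtype.ext (by ext a; simp [cup_apply, add_mul]))
    (fun c f g => Subtype.ext (by ext a; simp [cup_apply, mul_assoc]))
    (fun f g g' => Subtype.ext (by ext a; simp [cup_apply, mul_add]))
    (fun c f g => Subtype.ext (by ext a; simp [cup_apply, mul_left_comm]))

/-- The cup product on cohomology. -/
def cupHH (ε : A →A[k] k) (p q : ℕ) : HH ε p →ₗ[k] HH ε q →ₗ[k] HH ε (p + q) :=
  Submodule.liftQ _ (LinearMap.flip (Submodule.liftQ _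
    ((cupCocycles ε p q).compr₂ (cls ε (p + q))).flip
    (fun g hg => LinearMap.mem_ker.2 <| LinearMap.ext fun f =>
      (cls_eq_zero _).2 (cup_mem_coboundaries_right f.2 hg))))
    (fun f hf => LinearMap.mem_ker.2 <| LinearMap.ext fun x => by
      obtain ⟨g, rfl⟩ := cls_surjective ε q x
      exact (cls_eq_zero _).2 (cup_mem_coboundaries_left hf g.2))

theorem cupHH_cls (ε : A →A[k] k) {p q : ℕ} (f : cocycles ε p) (g : cocycles ε q) :
    cupHH ε p q (cls ε p f) (cls ε q g) = cls ε (p + q) (cupCocycles ε p q f g) := rfl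

theorem mk_cls_eq {ε : A →A[k] k} {m n : ℕ} (h : m = n) (f : cocycles ε m) (g : cocycles ε n)
    (H : ∀ a : Fin n → A, f.1 (fun i => a (Fin.cast h i)) = g.1 a) :
    GradedMonoid.mk (A := HH ε) m (cls ε m f) = GradedMonoid.mk n (cls ε n g) := by
  subst h
  exact congrArg (fun z => GradedMonoid.mk (A := HH ε) m (cls ε m z)) (Subtype.ext (Cochain.ext H))

/-- The unit cocycle. -/
def oneCocycle (ε : A →A[k] k) : cocycles ε 0 :=
  ⟨Cochain.ofMap (ContinuousMultilinearMap.constOfIsEmpty k _ 1), by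
    refine LinearMap.mem_ker.2 (Cochain.ext fun a => ?_)
    rw [d_apply]
    change ε (a 0) * 1 + _ + _ * (1 * ε (a (Fin.last 0))) = 0
    simp [Fin.last]⟩

theorem oneCocycle_apply (ε : A →A[k] k) (a : Fin 0 → A) : (oneCocycle ε).1 a = 1 := rfl

instance gMul (ε : A →A[k] k) : GradedMonoid.GMul (HH ε) where
  mul {p q} x y := cupHH ε p q x y

instance gOne (ε : A →A[k] k) : GradedMonoid.GOne (HH ε) where
  one := cls ε 0 (oneCocycle ε)

theorem gOne_def (ε : A →A[k] k) : (GradedMonoid.GOne.one : HH ε 0) = cls ε 0 (oneCocycle ε) := rfl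

theorem mk_mul_mk (ε : A →A[k] k) {p q : ℕ} (x : HH ε p) (y : HH ε q) :
    GradedMonoid.mk (A := HH ε) p x * GradedMonoid.mk q y =
      GradedMonoid.mk (p + q) (cupHH ε p q x y) := rfl

instance gMonoid (ε : A →A[k] k) : GradedMonoid.GMonoid (HH ε) where
  one_mul := by
    rintro ⟨n, x⟩
    obtain ⟨f, rfl⟩ := cls_surjective ε n x
    refine mk_cls_eq (zero_add n) (cupCocycles ε 0 n (oneCocycle ε) f) f fun a => ?_
    change cup _ _ _ = _
    rw [cup_apply]
    simp [oneCocycle_apply]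
  mul_one := by
    rintro ⟨n, x⟩
    obtain ⟨f, rfl⟩ := cls_surjective ε n x
    refine mk_cls_eq (add_zero n) (cupCocycles ε n 0 f (oneCocycle ε)) f fun a => ?_
    change cup _ _ _ = _
    rw [cup_apply]
    simp [oneCocycle_apply]
  mul_assoc := by
    rintro ⟨p, x⟩ ⟨q, y⟩ ⟨r, z⟩
    obtain ⟨f, rfl⟩ := cls_surjective ε p x
    obtain ⟨g, rfl⟩ := cls_surjective ε q y
    obtain ⟨h, rfl⟩ := cls_surjective ε r z
    refine mk_cls_eq (add_assoc p q r) (cupCocycles ε _ r (cupCocycles ε p q f g) h)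
      (cupCocycles ε p _ f (cupCocycles ε q r g h)) fun a => ?_
    change cup (cup _ _) _ _ = cup _ (cup _ _) _
    simp only [cup_apply, mul_assoc]
    congr 3
    funext i
    congr 1
    ext
    simp
    omega

instance gSemiring (ε : A →A[k] k) : DirectSum.GSemiring (HH ε) where
  mul_zero x := map_zero (cupHH ε _ _ x)
  zero_mul y := LinearMap.map_zero₂ (cupHH ε _ _) y
  mul_add x y z := map_add (cupHH ε _ _ x) y z
  add_mul x y z := LinearMap.map_add₂ (cupHH ε _ _) x y z
  natCast n := (n : k) • cls ε 0 (oneCocycle ε)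
  natCast_zero := by simp
  natCast_succ n := by
    rw [Nat.cast_succ, add_smul, one_smul]
    rfl

instance gRing (ε : A →A[k] k) : DirectSum.GRing (HH ε) where
  intCast n := (n : k) • cls ε 0 (oneCocycle ε)
  intCast_ofNat n := by
    rw [Int.cast_natCast]
    rfl
  intCast_negSucc_ofNat n := by
    rw [Int.cast_negSucc, neg_smul]
    rfl

theorem smul_one_mul (ε : A →A[k] k) (r : k) (x : GradedMonoid (HH ε)) :
    GradedMonoid.mk (A := HH ε) 0 (r • cls ε 0 (oneCocycle ε)) * x = r • x := by
  obtain ⟨n, x⟩ := x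
  obtain ⟨f, rfl⟩ := cls_surjective ε n x
  refine (mk_mul_mk ε _ _).trans ?_
  rw [map_smul, LinearMap.smul_apply]
  refine mk_cls_eq (zero_add n) (r • cupCocycles ε 0 n (oneCocycle ε) f) (r • f) fun a => ?_
  change r * cup _ _ _ = r * f.1 a
  rw [cup_apply]
  simp [oneCocycle_apply]

theorem mul_smul_one (ε : A →A[k] k) (r : k) (x : GradedMonoid (HH ε)) :
    x * GradedMonoid.mk (A := HH ε) 0 (r • cls ε 0 (oneCocycle ε)) = r • x := by
  obtain ⟨n, x⟩ := x
  obtain ⟨f, rfl⟩ := cls_surjective ε n x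
  refine (mk_mul_mk ε _ _).trans ?_
  rw [map_smul]
  refine mk_cls_eq (add_zero n) (r • cupCocycles ε n 0 f (oneCocycle ε)) (r • f) fun a => ?_
  change r * cup _ _ _ = r * f.1 a
  rw [cup_apply]
  simp [oneCocycle_apply]

instance gAlgebra (ε : A →A[k] k) : DirectSum.GAlgebra k (HH ε) where
  toFun := (LinearMap.toSpanSingleton k (HH ε 0) (cls ε 0 (oneCocycle ε))).toAddMonoidHom
  map_one := one_smul k (cls ε 0 (oneCocycle ε))
  map_mul r s := by
    refine Eq.trans ?_ (smul_one_mul ε r (.mk 0 (s • cls ε 0 (oneCocycle ε)))).symm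
    change GradedMonoid.mk (A := HH ε) 0 ((r * s) • cls ε 0 (oneCocycle ε)) = _
    rw [mul_smul]
    rfl
  commutes r x := (smul_one_mul ε r x).trans (mul_smul_one ε r x).symm
  smul_def r x := (smul_one_mul ε r x).symm

/-- The graded algebra `HH*(A, k)` with the cup product. -/
abbrev HHAlgebra (ε : A →A[k] k) : Type _ := DirectSum ℕ (HH ε)

end Cohomology

end ContHochschild

namespace Dirichlet

/-! ### Finite subgroups of the rational circle -/

/-! There is exactly one finite subgroup of `ℚ/ℤ` of each order, and it is cyclic. So intervals are
classified by the index, and the algebra has the topological basis `mono k n` with `mono k m * mono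
k n = mono k (m * n)`. A continuous multilinear form with values in a discrete field vanishes once
some argument has sufficiently many zero initial coefficients (`exists_vanish`). Hence `n`-cochains
are the finitely supported functions on `n`-tuples of positive integers (`val_injective`,
`boundedWeight_val`, `exists_val_eq`). The complex is the finitely supported dual of the bar complex
of the multiplicative monoid `ℕ+`, which is free commutative on the primes, so the answer should be
dual to the Koszul computation of Tor over a polynomial ring.

Upper bound: fix a prime `p`, and let `K` be the complex of cochains with an additional argument
`c`, standing for the power `p ^ c`, with differential `primeD`. The families concentrated at `c =
0` form the original complex, which is the kernel of the surjective chain map `F ↦ F (· + 1)` on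
`K`. An explicit homotopy contracts `K` onto the cochains at `c = 0` supported on tuples prime to
`p` (`primeD_primeS`). Chasing the resulting exact sequence writes each cocycle of positive degree
as a cocycle supported prime to `p`, plus a coboundary, plus the class of `p` times a cocycle of
lower degree (`exists_splitting`, `exists_cocycle_splitting`). Only finitely many primes meet the
support, and in positive degree a cocycle supported on `(1, …, 1)` is a coboundary. So the classes
of the primes generate (`exists_fromExterior_eq`).

Relations: the classes of `p` and `q` anticommute because the coefficient at `p * q` has the right
coboundary (`primeClass_mul_add`). As `2` is invertible, squares vanish too, which gives
`fromExterior`.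

Lower bound: antisymmetrizing a cochain over the permutations of a tuple of monomials different from
`1` kills coboundaries, because the monomials commute (`altValue_d`). On products of prime classes
these functionals give the dual basis (`altValue_prod`), so `fromExterior` is injective. Graded
commutativity then comes from the exterior algebra. -/

theorem ext_finSubgroup {X Y : FinSubgroup} (h : X.1 = Y.1) : X = Y := Subtype.ext h

theorem addOrderOf_one_div (n : ℕ+) :
    addOrderOf (((1 : ℚ) / (n : ℕ) : ℚ) : AddCircle (1 : ℚ)) = n :=
  AddCircle.addOrderOf_period_div (p := (1 : ℚ)) n.2

/-- The cyclic subgroup of order `n` of the rational numbers modulo `1`. -/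
noncomputable def cyc (n : ℕ+) : FinSubgroup :=
  ⟨AddSubgroup.zmultiples (((1 : ℚ) / (n : ℕ) : ℚ) : AddCircle (1 : ℚ)), by
    have h : IsOfFinAddOrder (((1 : ℚ) / (n : ℕ) : ℚ) : AddCircle (1 : ℚ)) := by
      exact addOrderOf_pos_iff.1 ((addOrderOf_one_div n).symm ▸ n.2)
    exact (finite_zmultiples.2 h : Set.Finite _)⟩

theorem card_cyc (n : ℕ+) : Nat.card (cyc n).1 = n := by
  change Nat.card (AddSubgroup.zmultiples _) = _
  rw [Nat.card_zmultiples, addOrderOf_one_div]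

/-- The order of a finite subgroup. -/
noncomputable def ord (X : FinSubgroup) : ℕ+ :=
  ⟨Nat.card X.1, by have := X.2; exact Nat.card_pos⟩

theorem ord_cyc (n : ℕ+) : ord (cyc n) = n := PNat.eq (card_cyc n)

theorem mem_cyc_of_nsmul_eq_zero {n : ℕ+} {u : AddCircle (1 : ℚ)} (h : (n : ℕ) • u = 0) :
    u ∈ (cyc n).1 := by
  obtain ⟨m, _, rfl⟩ := (AddCircle.nsmul_eq_zero_iff n.2).1 h
  refine AddSubgroup.mem_zmultiples_iff.2 ⟨m, ?_⟩
  rw [← AddCircle.coe_zsmul]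
  refine congrArg _ ?_
  rw [zsmul_eq_mul, Int.cast_natCast, mul_one, mul_one_div]
  rfl

theorem le_cyc_of_card_dvd {n : ℕ+} {X : FinSubgroup} (h : Nat.card X.1 ∣ n) : X ≤ cyc n := by
  intro u hu
  apply mem_cyc_of_nsmul_eq_zero
  have h1 : (n : ℕ) • (⟨u, hu⟩ : X.1) = 0 := by
    rw [← addOrderOf_dvd_iff_nsmul_eq_zero]
    exact (addOrderOf_dvd_natCard _).trans h
  simpa using congrArg Subtype.val h1

/-- The order of `X` annihilates `X`, so `X` lies in the cyclic group of that order; both have the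
same cardinality. -/
theorem eq_cyc_ord (X : FinSubgroup) : X = cyc (ord X) := by
  apply ext_finSubgroup
  have := (cyc (ord X)).2
  exact AddSubgroup.eq_of_le_of_card_ge (le_cyc_of_card_dvd (n := ord X) dvd_rfl)
    (card_cyc (ord X)).le

theorem cyc_one : cyc 1 = trivialSubgroup := by
  rw [eq_cyc_ord trivialSubgroup]
  congr 1
  apply PNat.eq
  change _ = Nat.card (⊥ : AddSubgroup (AddCircle (1 : ℚ)))
  simp

theorem trivialSubgroup_le (X : FinSubgroup) : trivialSubgroup ≤ X :=
  (bot_le : (⊥ : AddSubgroup (AddCircle (1 : ℚ))) ≤ X.1)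

/-- The index of `X` in `Y`. -/
noncomputable def idx (X Y : FinSubgroup) : ℕ+ :=
  ⟨X.1.relIndex Y.1, by
    have := Y.2
    exact Nat.pos_of_ne_zero AddSubgroup.index_ne_zero_of_finite⟩

theorem idx_trivialSubgroup (Y : FinSubgroup) : idx trivialSubgroup Y = ord Y :=
  PNat.eq (AddSubgroup.relIndex_bot_left Y.1)

theorem idx_mul_idx {X Y Z : FinSubgroup} (h1 : X ≤ Y) (h2 : Y ≤ Z) :
    idx X Y * idx Y Z = idx X Z :=
  PNat.eq (AddSubgroup.relIndex_mul_relIndex X.1 Y.1 Z.1 h1 h2)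

theorem isAddCyclic_quotient (X Y : FinSubgroup) :
    IsAddCyclic (Y.1 ⧸ X.1.addSubgroupOf Y.1) := by
  have hY : IsAddCyclic Y.1 := by
    rw [eq_cyc_ord Y]
    change IsAddCyclic (AddSubgroup.zmultiples _)
    infer_instance
  exact isAddCyclic_of_surjective (QuotientAddGroup.mk' _) (QuotientAddGroup.mk'_surjective _)

/-- The quotients are cyclic, and finite cyclic groups are determined by their order. -/
theorem quotientSetoid_iff (s t : NonemptyInterval FinSubgroup) :
    quotientSetoid s t ↔ idx s.fst s.snd = idx t.fst t.snd := by
  constructor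
  · rintro ⟨e⟩
    exact PNat.eq (Nat.card_congr e.toEquiv)
  · intro h
    have h1 := isAddCyclic_quotient s.fst s.snd
    have h2 := isAddCyclic_quotient t.fst t.snd
    exact ⟨addEquivOfAddCyclicCardEq (congrArg PNat.val h)⟩

/-! ### Coefficients of formal Dirichlet series -/

section Coefficients

variable (k : Type*) [Field k] [CharZero k]

/-- The `n`-th coefficient of a formal Dirichlet series. -/
noncomputable def coeff (n : ℕ+) : dirichletAlgebra k →ₗ[k] k where
  toFun f := (f : IncidenceAlgebra k FinSubgroup) trivialSubgroup (cyc n)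
  map_add' _ _ := rfl
  map_smul' _ _ := rfl

variable {k}

theorem apply_eq_coeff (f : dirichletAlgebra k) {X Y : FinSubgroup} (h : X ≤ Y) :
    (f : IncidenceAlgebra k FinSubgroup) X Y = coeff k (idx X Y) f := by
  refine f.2 ⟨(X, Y), h⟩ ⟨(trivialSubgroup, cyc (idx X Y)), trivialSubgroup_le _⟩ ?_
  rw [quotientSetoid_iff]
  change idx X Y = idx _ _
  rw [idx_trivialSubgroup, ord_cyc]

theorem ext_coeff {f g : dirichletAlgebra k} (h : ∀ n, coeff k n f = coeff k n g) : f = g := by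
  apply Subtype.ext
  apply IncidenceAlgebra.ext
  intro X Y hXY
  rw [apply_eq_coeff f hXY, apply_eq_coeff g hXY, h]

variable (k) in
/-- The formal Dirichlet series with given coefficients. -/
noncomputable def ofCoeff (c : ℕ+ → k) : dirichletAlgebra k :=
  ⟨⟨fun X Y => open scoped Classical in if X ≤ Y then c (idx X Y) else 0,
    fun _ _ h => if_neg h⟩, fun s t hst => by
      refine (if_pos s.fst_le_snd).trans (Eq.trans ?_ (if_pos t.fst_le_snd).symm)
      rw [(quotientSetoid_iff s t).1 hst]⟩

theorem ofCoeff_apply (c : ℕ+ → k) {X Y : FinSubgroup} (h : X ≤ Y) :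
    (ofCoeff k c : IncidenceAlgebra k FinSubgroup) X Y = c (idx X Y) := if_pos h

@[simp]
theorem coeff_ofCoeff (c : ℕ+ → k) (n : ℕ+) : coeff k n (ofCoeff k c) = c n := by
  refine (ofCoeff_apply c (trivialSubgroup_le _)).trans ?_
  rw [idx_trivialSubgroup, ord_cyc]

variable (k) in
/-- The formal Dirichlet series `n⁻ˢ`. -/
noncomputable def mono (n : ℕ+) : dirichletAlgebra k := ofCoeff k (Pi.single n 1)

theorem coeff_mono (m n : ℕ+) : coeff k m (mono k n) = if m = n then 1 else 0 := by
  rw [mono, coeff_ofCoeff, Pi.single_apply]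

theorem coeff_mul (f g : dirichletAlgebra k) (n : ℕ+) :
    coeff k n (f * g) = ∑ Z ∈ Finset.Icc trivialSubgroup (cyc n),
      coeff k (ord Z) f * coeff k (idx Z (cyc n)) g := by
  change ((f : IncidenceAlgebra k FinSubgroup) * (g : IncidenceAlgebra k FinSubgroup)) _ _ = _
  rw [IncidenceAlgebra.mul_apply]
  refine Finset.sum_congr rfl fun Z hZ => ?_
  rw [Finset.mem_Icc] at hZ
  rw [apply_eq_coeff f hZ.1, apply_eq_coeff g hZ.2, idx_trivialSubgroup]

theorem ord_mul_idx {Z : FinSubgroup} {n : ℕ+} (h : Z ≤ cyc n) :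
    ord Z * idx Z (cyc n) = n := by
  rw [← idx_trivialSubgroup, idx_mul_idx (trivialSubgroup_le _) h, idx_trivialSubgroup, ord_cyc]

/-- In the convolution at `m * n` only the unique subgroup of order `m` contributes. -/
theorem mono_mul_mono (m n : ℕ+) : mono k m * mono k n = mono k (m * n) := by
  classical
  refine ext_coeff fun N => ?_
  rw [coeff_mul]
  simp only [coeff_mono]
  by_cases h : N = m * n
  · subst h
    have hle : cyc m ≤ cyc (m * n) := le_cyc_of_card_dvd (by
      rw [card_cyc, PNat.mul_coe]
      exact dvd_mul_right _ _)
    rw [Finset.sum_eq_single (cyc m)]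
    · have := ord_mul_idx hle
      rw [ord_cyc] at this
      rw [ord_cyc, mul_left_cancel this]
      simp
    · intro Z _ hZ
      rw [if_neg, zero_mul]
      rintro rfl
      exact hZ (eq_cyc_ord Z)
    · intro h
      exact absurd (Finset.mem_Icc.2 ⟨trivialSubgroup_le _, hle⟩) h
  · rw [if_neg h]
    refine Finset.sum_eq_zero fun Z hZ => ?_
    have := ord_mul_idx (Finset.mem_Icc.1 hZ).2
    by_contra hne
    apply h
    rw [← this]
    split_ifs at hne with h1 h2
    · rw [h1, h2]
    all_goals simp at hne

/-! ### The topology in terms of coefficients. -/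

variable [TopologicalSpace k]

theorem continuous_coeff (n : ℕ+) : Continuous (coeff k n) :=
  (RedInc.continuous_apply trivialSubgroup (cyc n)).comp continuous_subtype_val

/-- The values on all intervals are continuous functions of the coefficients, so the topology is
already that of `ℕ+ → k`. -/
theorem isInducing_coeff :
    Topology.IsInducing fun (f : dirichletAlgebra k) (n : ℕ+) => coeff k n f := by
  classical
  have h1 : Topology.IsInducing fun (f : dirichletAlgebra k) (X Y : FinSubgroup) =>
      (f : IncidenceAlgebra k FinSubgroup) X Y :=
    (Topology.IsInducing.mk rfl : Topology.IsInducing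
      fun (f : IncidenceAlgebra k FinSubgroup) (X Y : FinSubgroup) => f X Y).comp .subtypeVal
  refine Topology.IsInducing.of_comp (g := fun (c : ℕ+ → k) (X Y : FinSubgroup) =>
    if X ≤ Y then c (idx X Y) else 0) (continuous_pi continuous_coeff) ?_ ?_
  · refine continuous_pi fun X => continuous_pi fun Y => ?_
    split_ifs
    · exact continuous_apply _
    · exact continuous_const
  · convert h1 using 1
    funext f X Y
    by_cases h : X ≤ Y
    · simp only [Function.comp_apply, if_pos h, apply_eq_coeff f h]
    · simp only [Function.comp_apply, if_neg h, IncidenceAlgebra.apply_eq_zero_of_not_le h]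

theorem exists_coeff_of_mem_nhds [DiscreteTopology k] {f : dirichletAlgebra k}
    {U : Set (dirichletAlgebra k)} (hU : U ∈ nhds f) :
    ∃ N : ℕ, ∀ g : dirichletAlgebra k,
      (∀ n : ℕ+, (n : ℕ) ≤ N → coeff k n g = coeff k n f) → g ∈ U := by
  rw [isInducing_coeff.nhds_eq_comap, Filter.mem_comap] at hU
  obtain ⟨V, hV, hVU⟩ := hU
  rw [nhds_pi, Filter.mem_pi] at hV
  obtain ⟨I, hI, t, ht, htV⟩ := hV
  refine ⟨hI.toFinset.sup fun n => (n : ℕ), fun g hg => hVU (htV fun n hn => ?_)⟩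
  change coeff k n g ∈ t n
  rw [hg n (Finset.le_sup (f := fun n : ℕ+ => (n : ℕ)) (hI.mem_toFinset.2 hn))]
  exact mem_of_mem_nhds (ht n)

theorem exists_coeff_of_mem_nhds_pi [DiscreteTopology k] {n : ℕ} {a : Fin n → dirichletAlgebra k}
    {U : Set (Fin n → dirichletAlgebra k)} (hU : U ∈ nhds a) :
    ∃ N : ℕ, ∀ b : Fin n → dirichletAlgebra k,
      (∀ i, ∀ m : ℕ+, (m : ℕ) ≤ N → coeff k m (b i) = coeff k m (a i)) → b ∈ U := by
  rw [nhds_pi, Filter.mem_pi] at hU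
  obtain ⟨I, hI, t, ht, htV⟩ := hU
  choose N hN using fun i => exists_coeff_of_mem_nhds (ht i)
  refine ⟨Finset.univ.sup N, fun b hb => htV fun i _ => hN i _ fun m hm => hb i m ?_⟩
  exact hm.trans (Finset.le_sup (Finset.mem_univ i))

variable [IsTopologicalRing k]

theorem augmentation_apply (f : dirichletAlgebra k) : augmentation k f = coeff k 1 f := by
  change (f : IncidenceAlgebra k FinSubgroup) trivialSubgroup trivialSubgroup =
    (f : IncidenceAlgebra k FinSubgroup) trivialSubgroup (cyc 1)
  rw [cyc_one]

theorem augmentation_mono (n : ℕ+) : augmentation k (mono k n) = if n = 1 then 1 else 0 := by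
  rw [augmentation_apply, coeff_mono]
  simp only [eq_comm]

end Coefficients

end Dirichlet

namespace Dirichlet

open ContHochschild

/-! ### Continuous cochains are finitely supported functions -/

section FiniteSupport

set_option linter.unusedSectionVars false

variable {k : Type*} [Field k] [CharZero k]

/-- The part of a formal Dirichlet series with indices greater than `N`. -/
noncomputable def tailSeries (N : ℕ) (a : dirichletAlgebra k) : dirichletAlgebra k :=
  ofCoeff k fun m => if (m : ℕ) ≤ N then 0 else coeff k m a

theorem coeff_tailSeries (N : ℕ) (a : dirichletAlgebra k) (m : ℕ+) :
    coeff k m (tailSeries N a) = if (m : ℕ) ≤ N then 0 else coeff k m a := coeff_ofCoeff _ _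

theorem eq_sum_add_tailSeries (N : ℕ) (a : dirichletAlgebra k) :
    a = ∑ x ∈ Finset.range N, coeff k x.succPNat a • mono k x.succPNat + tailSeries N a := by
  refine ext_coeff fun m => ?_
  rw [map_add, map_sum, coeff_tailSeries]
  simp only [map_smul, coeff_mono, smul_eq_mul, mul_ite, mul_one, mul_zero]
  obtain ⟨y, rfl⟩ : ∃ y : ℕ, y.succPNat = m := ⟨m.natPred, PNat.succPNat_natPred m⟩
  have h : ∀ x : ℕ, y.succPNat = x.succPNat ↔ y = x := fun x => Nat.succPNat_inj
  simp only [h, Finset.sum_ite_eq, Finset.mem_range, Nat.succPNat_coe, Nat.succ_le_iff]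
  split_ifs <;> simp

theorem coeff_mono_of_lt {N : ℕ} {m n : ℕ+} (hn : N < n) (hm : (m : ℕ) ≤ N) :
    coeff k m (mono k n) = 0 := by
  rw [coeff_mono, if_neg]
  rintro rfl
  omega

variable [TopologicalSpace k] [IsTopologicalRing k] {n : ℕ}

/-- Linearity in the `j`-th argument, applied to finitely many monomials and a remainder. The index
`x` stands for the monomial `x + 1`. -/
theorem cochain_expand (f : Cochain k (dirichletAlgebra k) n) (a : Fin n → dirichletAlgebra k)
    (j : Fin n) (N : ℕ) :
    f a = ∑ x ∈ Finset.range N,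
        coeff k x.succPNat (a j) * f (Function.update a j (mono k x.succPNat))
      + f (Function.update a j (tailSeries N (a j))) := by
  let L : dirichletAlgebra k →ₗ[k] k :=
    { toFun x := f (Function.update a j x)
      map_add' := f.map_update_add a j
      map_smul' := f.map_update_smul a j }
  have h : f a = L (a j) := congrArg f (Function.update_eq_self j a).symm
  rw [h]
  conv_lhs => rw [eq_sum_add_tailSeries N (a j)]
  rw [map_add, map_sum]
  simp only [map_smul, smul_eq_mul]
  rfl

theorem cochain_eq_zero_of_coord (f : Cochain k (dirichletAlgebra k) n)
    {a : Fin n → dirichletAlgebra k} {j : Fin n} (h : a j = 0) : f a = 0 := by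
  have := f.map_update_smul a j 0 0
  rwa [zero_mul, zero_smul, ← h, Function.update_eq_self] at this

variable [DiscreteTopology k]

/-- Continuity alone gives vanishing only when all free arguments are near zero. Expanding the
others into finitely many monomials and a tail makes one small argument suffice: each monomial fixes
one more argument, which allows induction on the set `T` of free positions. -/
theorem exists_vanish_of_agree (f : Cochain k (dirichletAlgebra k) n) (T : Finset (Fin n)) :
    ∀ a₀ : Fin n → dirichletAlgebra k, ∃ N : ℕ, ∀ a, (∀ i, i ∉ T → a i = a₀ i) →
      (∃ i ∈ T, ∀ m : ℕ+, (m : ℕ) ≤ N → coeff k m (a i) = 0) → f a = 0 := by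
  induction T using Finset.strongInduction with
  | H T ih =>
  intro a₀
  rcases T.eq_empty_or_nonempty with rfl | ⟨i₀, hi₀⟩
  · exact ⟨0, fun a _ ⟨i, hi, _⟩ => by simp at hi⟩
  -- As `T` is nonempty, `f` vanishes at this point, hence on a neighbourhood of it because `k` is
  -- discrete.
  let b₀ : Fin n → dirichletAlgebra k := fun i => if i ∈ T then 0 else a₀ i
  have hb₀ : f b₀ = 0 := cochain_eq_zero_of_coord f (j := i₀) (if_pos hi₀)
  have hU : f ⁻¹' {0} ∈ nhds b₀ :=
    f.cont.continuousAt.preimage_mem_nhds (by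
      rw [hb₀]
      exact (isOpen_discrete _).mem_nhds rfl)
  obtain ⟨N₀, hN₀⟩ := exists_coeff_of_mem_nhds_pi hU
  have key : ∀ (j : Fin n) (x : ℕ), ∃ N : ℕ, j ∈ T → ∀ a,
      (∀ i, i ∉ T.erase j → a i = Function.update a₀ j (mono k x.succPNat) i) →
      (∃ i ∈ T.erase j, ∀ m : ℕ+, (m : ℕ) ≤ N → coeff k m (a i) = 0) → f a = 0 := by
    intro j x
    by_cases hj : j ∈ T
    · obtain ⟨N, hN⟩ := ih _ (Finset.erase_ssubset hj) (Function.update a₀ j (mono k x.succPNat))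
      exact ⟨N, fun _ => hN⟩
    · exact ⟨0, fun h => absurd h hj⟩
  choose N₁ hN₁ using key
  -- Only the `N₀` leading monomials occur in the expansions, so finitely many bounds `N₁ j x` are
  -- needed.
  refine ⟨max N₀ (Finset.univ.sup fun j => (Finset.range N₀).sup (N₁ j)), ?_⟩
  have hle : ∀ j, ∀ x ∈ Finset.range N₀, N₁ j x ≤
      max N₀ (Finset.univ.sup fun j => (Finset.range N₀).sup (N₁ j)) := fun j x hx =>
    le_max_of_le_right ((Finset.le_sup (f := N₁ j) hx).trans
      (Finset.le_sup (f := fun j => (Finset.range N₀).sup (N₁ j)) (Finset.mem_univ j)))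
  have hN : N₀ ≤ max N₀ (Finset.univ.sup fun j => (Finset.range N₀).sup (N₁ j)) := le_max_left _ _
  generalize max N₀ (Finset.univ.sup fun j => (Finset.range N₀).sup (N₁ j)) = N at hle hN ⊢
  -- `J` contains the free positions not yet known to be small to order `N₀`; expanding at `j`
  -- removes it from `J`. For `J = ∅` the neighbourhood of `b₀` applies.
  have main : ∀ (J : Finset (Fin n)) (a : Fin n → dirichletAlgebra k),
      (∀ i, i ∉ T → a i = a₀ i) →
      (∃ i ∈ T, ∀ m : ℕ+, (m : ℕ) ≤ N → coeff k m (a i) = 0) →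
      (∀ j ∈ T, j ∉ J → ∀ m : ℕ+, (m : ℕ) ≤ N₀ → coeff k m (a j) = 0) → f a = 0 := by
    intro J
    induction J using Finset.induction_on with
    | empty =>
      intro a h1 _ h3
      refine hN₀ a fun i m hm => ?_
      by_cases hi : i ∈ T
      · rw [h3 i hi (Finset.notMem_empty i) m hm]
        simp [b₀, hi]
      · rw [h1 i hi]
        simp [b₀, hi]
    | insert j J _ ihJ =>
      rintro a h1 ⟨i, hi, h2⟩ h3
      by_cases hj : j ∈ T
      · rw [cochain_expand f a j N₀]
        have e1 : f (Function.update a j (tailSeries N₀ (a j))) = 0 := by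
          refine ihJ _ ?_ ⟨i, hi, ?_⟩ ?_
          · intro l hl
            rw [Function.update_of_ne fun h : l = j => hl (h ▸ hj), h1 l hl]
          · intro m hm
            rcases eq_or_ne i j with rfl | hij
            · rw [Function.update_self, coeff_tailSeries, h2 m hm, ite_self]
            · rw [Function.update_of_ne hij, h2 m hm]
          · intro l hl hlJ m hm
            rcases eq_or_ne l j with rfl | hlj
            · rw [Function.update_self, coeff_tailSeries, if_pos hm]
            · rw [Function.update_of_ne hlj]
              exact h3 l hl (by simp [hlj, hlJ]) m hm
        rw [e1, add_zero]
        refine Finset.sum_eq_zero fun x hx => ?_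
        rcases eq_or_ne i j with rfl | hij
        · rw [h2 _ (by
            rw [Nat.succPNat_coe]
            exact (Finset.mem_range.1 hx).trans_le hN), zero_mul]
        · rw [hN₁ j x hj, mul_zero]
          · intro l hl
            rcases eq_or_ne l j with rfl | hlj
            · simp
            · rw [Function.update_of_ne hlj, Function.update_of_ne hlj]
              exact h1 l fun h => hl (Finset.mem_erase.2 ⟨hlj, h⟩)
          · refine ⟨i, Finset.mem_erase.2 ⟨hij, hi⟩, fun m hm => ?_⟩
            rw [Function.update_of_ne hij]
            exact h2 m (hm.trans (hle j x hx))
      · refine ihJ a h1 ⟨i, hi, h2⟩ fun l hl hlJ => h3 l hl ?_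
        rw [Finset.mem_insert, not_or]
        exact ⟨fun h => hj (h ▸ hl), hlJ⟩
  exact fun a h1 h2 => main Finset.univ a h1 h2 fun j _ hj => absurd (Finset.mem_univ j) hj

theorem exists_vanish (f : Cochain k (dirichletAlgebra k) n) :
    ∃ N : ℕ, ∀ a, (∃ i, ∀ m : ℕ+, (m : ℕ) ≤ N → coeff k m (a i) = 0) → f a = 0 := by
  obtain ⟨N, hN⟩ := exists_vanish_of_agree f Finset.univ 0
  exact ⟨N, fun a ⟨i, hi⟩ => hN a (fun i hi => absurd (Finset.mem_univ i) hi)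
    ⟨i, Finset.mem_univ i, hi⟩⟩

end FiniteSupport

/-! ### The values of a cochain on monomials -/

section Values

set_option linter.unusedSectionVars false

variable {k : Type*} [Field k] [CharZero k] [TopologicalSpace k] [IsTopologicalRing k] {n : ℕ}

/-- The values of a cochain on monomials, as a function of sequences. -/
noncomputable def val (f : Cochain k (dirichletAlgebra k) n) (m : ℕ → ℕ+) : k :=
  f fun i : Fin n => mono k (m i)

/-- A function of sequences which depends only on the first `n` entries. -/
def DependsOnFirst (n : ℕ) (φ : (ℕ → ℕ+) → k) : Prop :=
  ∀ m m', (∀ x < n, m x = m' x) → φ m = φ m'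

/-- The product of the first `n` entries. -/
def weight (n : ℕ) (m : ℕ → ℕ+) : ℕ+ := ∏ x ∈ Finset.range n, m x

/-- A function of sequences which vanishes if the product of the first `n` entries is large. -/
def BoundedWeight (n : ℕ) (φ : (ℕ → ℕ+) → k) : Prop :=
  ∃ N : ℕ+, ∀ m, φ m ≠ 0 → weight n m ≤ N

theorem le_weight {m : ℕ → ℕ+} {x : ℕ} (hx : x < n) : m x ≤ weight n m :=
  PNat.le_of_dvd (Finset.dvd_prod_of_mem m (Finset.mem_range.2 hx))

theorem dependsOnFirst_val (f : Cochain k (dirichletAlgebra k) n) : DependsOnFirst n (val f) :=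
  fun _ _ h => congrArg f (funext fun i => by rw [h i i.2])

/-- Extension of a tuple to a sequence. -/
def extendOne (u : Fin n → ℕ+) (x : ℕ) : ℕ+ := if h : x < n then u ⟨x, h⟩ else 1

@[simp]
theorem extendOne_coe (u : Fin n → ℕ+) (i : Fin n) : extendOne u i = u i := dif_pos i.2

theorem val_extendOne (f : Cochain k (dirichletAlgebra k) n) (u : Fin n → ℕ+) :
    val f (extendOne u) = f fun i => mono k (u i) := by
  simp [val]

variable (k) in
/-- The product of coefficient functionals. -/
noncomputable def coeffCochain (u : Fin n → ℕ+) : Cochain k (dirichletAlgebra k) n :=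
  Cochain.ofMap ((ContinuousMultilinearMap.mkPiAlgebra k (Fin n) k).compContinuousLinearMap
    fun i => ⟨coeff k (u i), continuous_coeff (u i)⟩)

theorem coeffCochain_apply (u : Fin n → ℕ+) (a : Fin n → dirichletAlgebra k) :
    coeffCochain k u a = ∏ i, coeff k (u i) (a i) := by
  change ContinuousMultilinearMap.compContinuousLinearMap _ _ a = _
  simp

/-- A bound on the weight leaves finitely many tuples, so a finite combination of products of
coefficient functionals has these values. Continuity is then automatic. -/
theorem exists_val_eq {φ : (ℕ → ℕ+) → k} (h1 : DependsOnFirst n φ) (h2 : BoundedWeight n φ) :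
    ∃ f : Cochain k (dirichletAlgebra k) n, val f = φ := by
  classical
  obtain ⟨N, hN⟩ := h2
  refine ⟨∑ u ∈ Fintype.piFinset fun _ : Fin n => Finset.Icc 1 N,
    φ (extendOne u) • coeffCochain k u, funext fun m => ?_⟩
  rw [val, Cochain.sum_apply]
  simp only [Cochain.smul_apply, coeffCochain_apply, coeff_mono]
  have h3 : φ (extendOne fun i : Fin n => m i) = φ m :=
    h1 _ _ fun x hx => extendOne_coe (fun i : Fin n => m i) ⟨x, hx⟩
  rw [Finset.sum_eq_single fun i : Fin n => m i]
  · simp [h3]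
  · intro u _ hu
    obtain ⟨i, hi⟩ := Function.ne_iff.1 hu
    rw [Finset.prod_eq_zero (Finset.mem_univ i) (if_neg hi), mul_zero]
  · intro hm
    rw [h3]
    by_contra hne
    refine hm (Fintype.mem_piFinset.2 fun i => Finset.mem_Icc.2 ⟨one_le, ?_⟩)
    exact (le_weight i.2).trans (hN m fun h => hne (by rw [h, zero_mul]))

variable [DiscreteTopology k]

/-- A large monomial has no small coefficients, so `exists_vanish` bounds every entry of a tuple in
the support. -/
theorem boundedWeight_val (f : Cochain k (dirichletAlgebra k) n) : BoundedWeight n (val f) := by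
  obtain ⟨N, hN⟩ := exists_vanish f
  refine ⟨N.succPNat ^ n, fun m hm => ?_⟩
  have h : ∀ x ∈ Finset.range n, m x ≤ N.succPNat := by
    intro x hx
    by_contra hlt
    refine hm (hN _ ⟨⟨x, Finset.mem_range.1 hx⟩, fun l hl => ?_⟩)
    refine coeff_mono_of_lt (N := N) ?_ hl
    have : N.succPNat < m x := not_le.1 hlt
    rw [← PNat.coe_lt_coe, Nat.succPNat_coe] at this
    simp only
    omega
  simpa [weight] using Finset.prod_le_pow_card (Finset.range n) m _ h

/-- Every argument is expanded into monomials and a tail, and `exists_vanish` kills the tail terms.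
-/
theorem val_injective : Function.Injective (val (k := k) (n := n)) := by
  intro f g hfg
  obtain ⟨N, hN⟩ := exists_vanish (f - g)
  have main : ∀ (J : Finset (Fin n)) (a : Fin n → dirichletAlgebra k),
      (∀ i, i ∉ J → ∃ m, a i = mono k m) → (f - g) a = 0 := by
    intro J
    induction J using Finset.induction_on with
    | empty =>
      intro a h
      choose m hm using fun i => h i (Finset.notMem_empty i)
      obtain rfl : a = fun i => mono k (m i) := funext hm
      have := congrFun hfg (extendOne m)
      rw [val_extendOne, val_extendOne] at this
      exact sub_eq_zero.2 this
    | insert j J _ ih =>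
      intro a h
      rw [cochain_expand _ a j N, hN, add_zero]
      · refine Finset.sum_eq_zero fun x _ => ?_
        rw [ih, mul_zero]
        intro i hi
        rcases eq_or_ne i j with rfl | hij
        · exact ⟨_, Function.update_self _ _ _⟩
        · rw [Function.update_of_ne hij]
          exact h i (by simp [hij, hi])
      · refine ⟨j, fun m hm => ?_⟩
        rw [Function.update_self, coeff_tailSeries, if_pos hm]
  rw [← sub_eq_zero]
  ext a
  exact main Finset.univ a fun i hi => absurd (Finset.mem_univ i) hi

end Values

/-! ### The differential on values -/

section Differential

/-- The `j`-th face of a sequence. -/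
def seqFace {M : Type*} [Mul M] (j : ℕ) (m : ℕ → M) (x : ℕ) : M :=
  if x + 1 < j then m x else if x + 1 = j then m x * m (x + 1) else m (x + 1)

/-- The Hochschild differential on functions of sequences. -/
def seqD {k : Type*} [Field k] (n : ℕ) (φ : (ℕ → ℕ+) → k) (m : ℕ → ℕ+) : k :=
  ∑ j ∈ Finset.range (n + 2), (-1 : k) ^ j *
    if (j = 0 → m 0 = 1) ∧ (j = n + 1 → m n = 1) then φ (seqFace j m) else 0

variable {k : Type*} [Field k] [CharZero k] [TopologicalSpace k] [IsTopologicalRing k] {n : ℕ}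

/-- Faces of monomials are monomials, and the augmentation turns the two outer faces into the
conditions that the entry dropped be `1`. -/
theorem val_d (f : Cochain k (dirichletAlgebra k) n) :
    val (d (augmentation k) n f) = seqD n (val f) := by
  funext m
  rw [val, d_apply_faces, seqD, ← Fin.sum_univ_eq_sum_range (fun j => (-1 : k) ^ j *
    if (j = 0 → m 0 = 1) ∧ (j = n + 1 → m n = 1) then val f (seqFace j m) else 0)]
  refine Finset.sum_congr rfl fun j _ => ?_
  congr 1
  have h1 : faceTuple (j : ℕ) (fun i : Fin (n + 1) => mono k (m i)) =
      fun i : Fin n => mono k (seqFace j m i) := by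
    funext i
    simp only [faceTuple, seqFace, Fin.val_castSucc, Fin.val_succ, mono_mul_mono]
    split_ifs <;> rfl
  rw [h1, faceScalar]
  simp only [augmentation_mono, Fin.val_zero, Fin.val_last]
  change _ * val f (seqFace j m) = _
  by_cases h2 : (j : ℕ) = 0 <;> by_cases h3 : (j : ℕ) = n + 1 <;>
    by_cases h4 : m 0 = 1 <;> by_cases h5 : m n = 1 <;> simp [h2, h3, h4, h5]

end Differential

end Dirichlet

namespace Dirichlet

/-! ### Exponents of a prime -/

section Exponents

/-- The exponent of a prime in a positive integer. -/
def pexp (p : Nat.Primes) (m : ℕ+) : ℕ := (m : ℕ).factorization p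

/-- The largest divisor which is prime to `p`. -/
def pfree (p : Nat.Primes) (m : ℕ+) : ℕ+ :=
  ⟨(m : ℕ) / (p : ℕ) ^ (m : ℕ).factorization p, Nat.ordCompl_pos p m.ne_zero⟩

variable (p : Nat.Primes)

theorem pexp_mul (m n : ℕ+) : pexp p (m * n) = pexp p m + pexp p n := by
  simp [pexp, Nat.factorization_mul]

@[simp]
theorem pexp_one : pexp p 1 = 0 := by simp [pexp]

theorem pfree_mul (m n : ℕ+) : pfree p (m * n) = pfree p m * pfree p n :=
  PNat.eq (Nat.ordCompl_mul m n p)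

theorem pow_pexp_mul_pfree (m : ℕ+) : (p : ℕ+) ^ pexp p m * pfree p m = m :=
  PNat.eq (Nat.ordProj_mul_ordCompl_eq_self m p)

@[simp]
theorem pexp_pow (c : ℕ) : pexp p ((p : ℕ+) ^ c) = c := by
  change ((p : ℕ+) ^ c : ℕ+).val.factorization p = c
  rw [PNat.pow_coe, Nat.Primes.coe_pnat_nat, p.2.factorization_pow]
  simp

theorem pfree_eq_self {m : ℕ+} (h : pexp p m = 0) : pfree p m = m := by
  have := pow_pexp_mul_pfree p m
  rwa [h, pow_zero, one_mul] at this

@[simp]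
theorem pfree_pow (c : ℕ) : pfree p ((p : ℕ+) ^ c) = 1 := by
  have := pow_pexp_mul_pfree p ((p : ℕ+) ^ c)
  rw [pexp_pow] at this
  exact mul_left_cancel (this.trans (mul_one _).symm)

@[simp]
theorem pexp_pfree (m : ℕ+) : pexp p (pfree p m) = 0 := by
  have := congrArg (pexp p) (pow_pexp_mul_pfree p m)
  rw [pexp_mul, pexp_pow] at this
  omega

@[simp]
theorem pfree_pfree (m : ℕ+) : pfree p (pfree p m) = pfree p m := pfree_eq_self p (pexp_pfree p m)

theorem eq_pow_of_pfree_eq_one {m : ℕ+} (h : pfree p m = 1) : m = (p : ℕ+) ^ pexp p m := by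
  have := pow_pexp_mul_pfree p m
  rw [h, mul_one] at this
  exact this.symm

theorem eq_one_iff_pfree {m : ℕ+} : m = 1 ↔ pfree p m = 1 ∧ pexp p m = 0 := by
  constructor
  · rintro rfl
    exact ⟨pfree_eq_self p (pexp_one p), pexp_one p⟩
  · rintro ⟨h1, h2⟩
    rw [eq_pow_of_pfree_eq_one p h1, h2, pow_zero]

theorem eq_prime_iff_pfree {m : ℕ+} : m = p ↔ pfree p m = 1 ∧ pexp p m = 1 := by
  constructor
  · rintro rfl
    have h1 := pfree_pow p 1
    have h2 := pexp_pow p 1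
    rw [pow_one] at h1 h2
    exact ⟨h1, h2⟩
  · rintro ⟨h1, h2⟩
    rw [eq_pow_of_pfree_eq_one p h1, h2, pow_one]

theorem pnat_mul_eq_one {m n : ℕ+} : m * n = 1 ↔ m = 1 ∧ n = 1 := by
  refine ⟨fun h => ?_, fun ⟨h1, h2⟩ => by rw [h1, h2, mul_one]⟩
  have h' : (m : ℕ) * n = 1 := congrArg PNat.val h
  exact ⟨PNat.eq (Nat.eq_one_of_mul_eq_one_right h'), PNat.eq (Nat.eq_one_of_mul_eq_one_left h')⟩

theorem pfree_mul_eq_one {m n : ℕ+} : pfree p (m * n) = 1 ↔ pfree p m = 1 ∧ pfree p n = 1 := by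
  rw [pfree_mul, pnat_mul_eq_one]

theorem eq_one_of_pexp {m : ℕ+} (h : ∀ p, pexp p m = 0) : m = 1 := by
  apply PNat.eq
  refine Nat.eq_of_factorization_eq m.ne_zero one_ne_zero fun q => ?_
  by_cases hq : q.Prime
  · simpa [pexp] using h ⟨q, hq⟩
  · simp [Nat.factorization_eq_zero_of_not_prime _ hq]

end Exponents

/-! ### Faces and weights -/

section Weights

variable {n : ℕ} (m : ℕ → ℕ+)

theorem weight_succ : weight (n + 1) m = weight n m * m n := Finset.prod_range_succ _ _

theorem weight_succ' : weight (n + 1) m = m 0 * weight n (seqFace 0 m) := by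
  rw [weight, Finset.prod_range_succ', mul_comm]
  rfl

theorem weight_congr {m m' : ℕ → ℕ+} (h : ∀ x < n, m x = m' x) : weight n m = weight n m' :=
  Finset.prod_congr rfl fun x hx => h x (Finset.mem_range.1 hx)

theorem weight_seqFace_of_lt {i j : ℕ} (h : i < j) : weight i (seqFace j m) = weight i m :=
  weight_congr fun x hx => if_pos (by omega)

theorem weight_seqFace {i j : ℕ} (hj : j ≠ 0) (h : j ≤ i) :
    weight i (seqFace j m) = weight (i + 1) m := by
  induction i, h using Nat.le_induction with
  | base =>
    obtain ⟨j, rfl⟩ := Nat.exists_eq_succ_of_ne_zero hj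
    rw [weight_succ, weight_seqFace_of_lt _ (Nat.lt_succ_self j), weight_succ, weight_succ,
      mul_assoc]
    simp [seqFace]
  | succ i h ih =>
    rw [weight_succ, ih, weight_succ m (n := i + 1)]
    congr 1
    rw [seqFace, if_neg (by omega), if_neg (by omega)]

theorem seqFace_congr {j : ℕ} {m m' : ℕ → ℕ+} (h : ∀ x < n + 1, m x = m' x) :
    ∀ x < n, seqFace j m x = seqFace j m' x := by
  intro x hx
  simp only [seqFace, h x (by omega), h (x + 1) (by omega)]

theorem seqFace_seqFace {i j : ℕ} (hij : i ≤ j) :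
    seqFace i (seqFace (j + 1) m) = seqFace j (seqFace i m) := by
  ext1 x
  simp only [seqFace]
  split_ifs <;> first | rfl | omega | exact mul_assoc _ _ _ | exact (mul_assoc _ _ _).symm

end Weights

/-! ### Cochains with coefficients in the functions on the powers of a prime -/

section Complex

variable {k : Type*} [Field k] (p : Nat.Primes)

/-- The differential on cochains with coefficients in the functions on the powers of `p`. -/
def primeD (n : ℕ) (F : ℕ → (ℕ → ℕ+) → k) (c : ℕ) (m : ℕ → ℕ+) : k :=
  ∑ j ∈ Finset.range (n + 2), (-1 : k) ^ j *
    if (j = 0 → pfree p (m 0) = 1) ∧ (j = n + 1 → m n = 1) then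
      F (if j = 0 then c + pexp p (m 0) else c) (seqFace j m) else 0

/-- The simplicial identities cancel the faces in pairs. For the two faces at the coefficient this
is the statement that `ℕ+` acts on the powers of `p`, other primes acting by zero. -/
theorem primeD_primeD (n : ℕ) (F : ℕ → (ℕ → ℕ+) → k) :
    primeD p (n + 1) (primeD p n F) = 0 := by
  -- The cancellation lemma `sum_sum_eq_zero` is stated over a topological field; any topology will
  -- do.
  let _ : TopologicalSpace k := ⊥
  have : DiscreteTopology k := ⟨rfl⟩
  funext c m
  simp only [primeD]
  refine Eq.trans ?_ (ContHochschild.sum_sum_eq_zero (k := k) (n + 1)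
    (fun i j => (-1 : k) ^ (i + j) * if ((i = 0 → pfree p (m 0) = 1) ∧ (i = n + 1 + 1 →
      m (n + 1) = 1)) ∧ ((j = 0 → pfree p (seqFace i m 0) = 1) ∧ (j = n + 1 → seqFace i m n = 1))
      then F (if j = 0 then (if i = 0 then c + pexp p (m 0) else c) + pexp p (seqFace i m 0)
        else if i = 0 then c + pexp p (m 0) else c) (seqFace j (seqFace i m)) else 0) ?_)
  · rw [← Fin.sum_univ_eq_sum_range (n := n + 1 + 2) (f := fun i => (-1 : k) ^ i * ite _ _ _)]
    refine Finset.sum_congr rfl fun i _ => ?_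
    by_cases h : ((i : ℕ) = 0 → pfree p (m 0) = 1) ∧ ((i : ℕ) = n + 1 + 1 → m (n + 1) = 1)
    · rw [if_pos h, Finset.mul_sum, ← Fin.sum_univ_eq_sum_range
        (f := fun j => (-1 : k) ^ (i : ℕ) * ((-1 : k) ^ j * ite _ _ _))]
      refine Finset.sum_congr rfl fun j _ => ?_
      rw [if_congr (and_iff_right h) rfl rfl, ← mul_assoc, ← pow_add]
    · rw [if_neg h, mul_zero]
      refine (Finset.sum_eq_zero fun j _ => ?_).symm
      rw [if_neg fun h' => h h'.1, mul_zero]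
  · intro i j hij hj
    rw [seqFace_seqFace m hij]
    have e : (-1 : k) ^ (j + 1 + i) = - (-1 : k) ^ (i + j) := by ring
    rw [e, neg_mul]
    congr 2
    have h1 : ¬ j + 1 = 0 := by omega
    have h2 : ¬ i = n + 1 + 1 := by omega
    simp only [h1, h2, false_imp_iff, true_and, and_true, if_false]
    have h3 : i = n + 1 → j = n + 1 := by omega
    have h4 : j = 0 → i = 0 := by omega
    by_cases hj0 : j = 0
    · obtain rfl := h4 hj0
      subst hj0
      simp [seqFace, pfree_mul_eq_one, pexp_mul, add_assoc]
    · have e0 : seqFace (j + 1) m 0 = m 0 := if_pos (by omega)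
      simp only [e0, hj0, false_imp_iff, true_and, if_false]
      refine if_congr ?_ rfl rfl
      rcases eq_or_ne j (n + 1) with rfl | hjn
      · have e1 : seqFace (n + 1 + 1) m n = m n := if_pos (by omega)
        rcases eq_or_ne i (n + 1) with rfl | hin
        · have e2 : seqFace (n + 1) m n = m n * m (n + 1) := by simp [seqFace]
          simp [e1, e2, pnat_mul_eq_one]
          tauto
        · have e2 : seqFace i m n = m (n + 1) := by
            rw [seqFace, if_neg (by omega), if_neg (by omega)]
          simp [e2, hin]
          tauto
      · have hin : i ≠ n + 1 := fun h => hjn (h3 h)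
        simp [hjn, hin]

/-- The sequences of the homotopy. -/
def homotopySeq (i c : ℕ) (m : ℕ → ℕ+) (x : ℕ) : ℕ+ :=
  if x < i then pfree p (m x) else
    if x = i then (p : ℕ+) ^ (c + pexp p (weight i m)) else m (x - 1)

/-- The contracting homotopy. -/
def primeS (n : ℕ) (F : ℕ → (ℕ → ℕ+) → k) (c : ℕ) (m : ℕ → ℕ+) : k :=
  ∑ i ∈ Finset.range (n + 1), (-1 : k) ^ i * F 0 (homotopySeq p i c m)

/-! ### Faces of the sequences of the homotopy, and the homotopy formula. -/

theorem seqFace_homotopySeq_diag (i c : ℕ) (m : ℕ → ℕ+) :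
    seqFace (i + 1) (homotopySeq p (i + 1) c m) = seqFace (i + 1) (homotopySeq p i c m) := by
  ext1 x
  simp only [seqFace, homotopySeq]
  rcases lt_trichotomy x i with h | rfl | h
  · rw [if_pos (by omega), if_pos (by omega), if_pos (by omega), if_pos h]
  · rw [weight_succ, pexp_mul]
    simp only [lt_irrefl, if_true, if_false, lt_add_iff_pos_right, zero_lt_one,
      Nat.add_sub_cancel, add_eq_left, one_ne_zero, not_lt.2 (Nat.le_succ x)]
    -- Merging the inserted power with `m x` gives the same product from either side: the `p`-part
    -- of `m x` only changes its place.
    conv_rhs => rw [← pow_pexp_mul_pfree p (m x)]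
    rw [← add_assoc, pow_add _ (c + _), mul_comm, mul_assoc]
  · rw [if_neg (by omega), if_neg (by omega), if_neg (by omega), if_neg (by omega),
      if_neg (by omega), if_neg (by omega), if_neg (by omega), if_neg (by omega)]

/-- Merging entries before the inserted power does not change the exponent it collects; for `j = 0`
the exponent of the lost entry passes into `c`. -/
theorem seqFace_homotopySeq_of_le {i j : ℕ} (h : j ≤ i) (c : ℕ) (m : ℕ → ℕ+) :
    seqFace j (homotopySeq p (i + 1) c m) =
      homotopySeq p i (if j = 0 then c + pexp p (m 0) else c) (seqFace j m) := by
  have hw : c + pexp p (weight (i + 1) m) =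
      (if j = 0 then c + pexp p (m 0) else c) + pexp p (weight i (seqFace j m)) := by
    split_ifs with hj
    · rw [hj, weight_succ', pexp_mul, add_assoc]
    · rw [weight_seqFace m hj h]
  ext1 x
  simp only [seqFace, homotopySeq, hw]
  rcases lt_trichotomy x i with hx | rfl | hx
  · rcases lt_trichotomy (x + 1) j with h1 | h1 | h1
    · simp [h1, hx, hx.trans (Nat.lt_succ_self i)]
    · simp [h1, hx, hx.trans (Nat.lt_succ_self i), pfree_mul]
      omega
    · simp [h1.ne', not_lt.2 h1.le, hx]
  · have h1 : ¬ x + 1 < j := by omega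
    have h2 : ¬ x + 1 = j := by omega
    simp [h1, h2]
  · have h1 : ¬ x + 1 < j := by omega
    have h2 : ¬ x + 1 = j := by omega
    have h5 : x - 1 + 1 = x := by omega
    have h6 : ¬ x < i := by omega
    have h7 : ¬ x = i := by omega
    have h8 : ¬ x < j := by omega
    have h9 : ¬ x = j := by omega
    simp [h1, h2, h5, h6, h7, h8, h9]

theorem seqFace_homotopySeq_of_lt {i j : ℕ} (h : i < j) (c : ℕ) (m : ℕ → ℕ+) :
    seqFace (j + 1) (homotopySeq p i c m) = homotopySeq p i c (seqFace j m) := by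
  ext1 x
  simp only [seqFace, homotopySeq, weight_seqFace_of_lt m h]
  rcases lt_trichotomy x i with hx | rfl | hx
  · have h1 : x + 1 < j := by omega
    have h2 : x < j := by omega
    simp [hx, h1, h2]
  · simp [h]
  · obtain ⟨y, rfl⟩ : ∃ y, x = y + 1 := ⟨x - 1, by omega⟩
    have h1 : ¬ y + 1 < i := by omega
    have h2 : ¬ y + 1 = i := by omega
    have h3 : ¬ y + 1 + 1 < i := by omega
    have h4 : ¬ y + 1 + 1 = i := by omega
    simp [h1, h2, h3, h4]

/-- The sign bookkeeping of a simplicial homotopy. `T i j` is the `j`-th face of the `i`-th inserted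
sequence, `U i j` the `i`-th insertion in the `j`-th face. Faces away from the insertion cancel
between `T` and `U`; the faces `j = i` and `j = i + 1` telescope, leaving the two ends. -/
theorem sum_homotopy (n : ℕ) (T U : ℕ → ℕ → k)
    (h1 : ∀ i ≤ n, T (i + 1) (i + 1) = T i (i + 1))
    (h2 : ∀ i ≤ n, ∀ j ≤ i, T (i + 1) j = U i j)
    (h3 : ∀ j ≤ n + 1, ∀ i < j, T i (j + 1) = U i j) :
    ∑ j ∈ Finset.range (n + 2), ∑ i ∈ Finset.range (n + 1), (-1 : k) ^ (i + j) * U i j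
      + ∑ i ∈ Finset.range (n + 2), ∑ j ∈ Finset.range (n + 3), (-1 : k) ^ (i + j) * T i j =
      T 0 0 - T (n + 1) (n + 2) := by
  have key : ∀ i ∈ Finset.range (n + 2), ∑ j ∈ Finset.range (n + 3), (-1 : k) ^ (i + j) * T i j =
      ∑ j ∈ Finset.range (n + 3), (if j < i then (-1 : k) ^ (i + j) * T i j else 0)
      + ∑ j ∈ Finset.range (n + 3), (if i + 1 < j then (-1 : k) ^ (i + j) * T i j else 0)
      + (T i i - T i (i + 1)) := by
    intro i hi
    rw [Finset.mem_range] at hi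
    have e1 : T i i - T i (i + 1) =
        ∑ j ∈ Finset.range (n + 3), (if i = j then (-1 : k) ^ (i + j) * T i j else 0)
        + ∑ j ∈ Finset.range (n + 3), (if i + 1 = j then (-1 : k) ^ (i + j) * T i j else 0) := by
      rw [Finset.sum_ite_eq, Finset.sum_ite_eq, if_pos (by simp; omega), if_pos (by simp; omega)]
      have : (-1 : k) ^ (i + i) = 1 := Even.neg_one_pow ⟨i, rfl⟩
      rw [← add_assoc, pow_succ, this]
      ring
    rw [e1, ← Finset.sum_add_distrib, ← Finset.sum_add_distrib, ← Finset.sum_add_distrib]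
    refine Finset.sum_congr rfl fun j _ => ?_
    rcases lt_trichotomy j i with h | h | h
    · simp [h, h.ne', show ¬ i + 1 < j by omega, show ¬ i + 1 = j by omega]
    · simp [h]
    · rcases eq_or_lt_of_le (Nat.succ_le_of_lt h) with h' | h'
      · simp [← h']
      · simp [h', show ¬ j < i by omega, h.ne, show ¬ i + 1 = j by omega]
  rw [Finset.sum_congr rfl key, Finset.sum_add_distrib, Finset.sum_add_distrib]
  have e2 : ∑ i ∈ Finset.range (n + 2), ∑ j ∈ Finset.range (n + 3),
      (if j < i then (-1 : k) ^ (i + j) * T i j else 0) =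
      - ∑ i ∈ Finset.range (n + 1), ∑ j ∈ Finset.range (n + 2),
        (if j ≤ i then (-1 : k) ^ (i + j) * U i j else 0) := by
    rw [Finset.sum_range_succ', ← Finset.sum_neg_distrib]
    simp only [Nat.not_lt_zero, if_false, Finset.sum_const_zero, add_zero]
    refine Finset.sum_congr rfl fun i hi => ?_
    rw [Finset.mem_range] at hi
    rw [Finset.sum_range_succ, if_neg (by omega), add_zero, ← Finset.sum_neg_distrib]
    refine Finset.sum_congr rfl fun j _ => ?_
    by_cases hj : j ≤ i
    · rw [if_pos (by omega), if_pos hj, h2 i (by omega) j hj]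
      ring
    · rw [if_neg (by omega), if_neg hj, neg_zero]
  have e3 : ∑ i ∈ Finset.range (n + 2), ∑ j ∈ Finset.range (n + 3),
      (if i + 1 < j then (-1 : k) ^ (i + j) * T i j else 0) =
      - ∑ i ∈ Finset.range (n + 1), ∑ j ∈ Finset.range (n + 2),
        (if i < j then (-1 : k) ^ (i + j) * U i j else 0) := by
    rw [Finset.sum_range_succ, ← Finset.sum_neg_distrib]
    rw [Finset.sum_eq_zero (s := Finset.range (n + 3))
      (f := fun j => if n + 1 + 1 < j then (-1 : k) ^ (n + 1 + j) * T (n + 1) j else 0), add_zero]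
    · refine Finset.sum_congr rfl fun i hi => ?_
      rw [Finset.sum_range_succ', if_neg (by omega), add_zero, ← Finset.sum_neg_distrib]
      refine Finset.sum_congr rfl fun j hj => ?_
      rw [Finset.mem_range] at hj
      by_cases hij : i < j
      · rw [if_pos (by omega), if_pos hij, h3 j (by omega) i hij]
        ring
      · rw [if_neg (by omega), if_neg hij, neg_zero]
    · intro j hj
      rw [Finset.mem_range] at hj
      exact if_neg (by omega)
  have e4 : ∑ i ∈ Finset.range (n + 2), (T i i - T i (i + 1)) = T 0 0 - T (n + 1) (n + 2) := by
    rw [Finset.sum_sub_distrib, Finset.sum_range_succ', Finset.sum_range_succ _ (n + 1),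
      Finset.sum_congr rfl fun i hi => h1 i (by rw [Finset.mem_range] at hi; omega)]
    ring
  rw [e2, e3, e4, Finset.sum_comm]
  have e5 : ∀ i j, (-1 : k) ^ (i + j) * U i j =
      (if j ≤ i then (-1 : k) ^ (i + j) * U i j else 0)
      + (if i < j then (-1 : k) ^ (i + j) * U i j else 0) := by
    intro i j
    by_cases h : j ≤ i
    · simp [h, not_lt.2 h]
    · simp [h, not_le.1 h]
  simp only [fun i => Finset.sum_congr rfl fun j (_ : j ∈ Finset.range (n + 2)) => e5 i j,
    Finset.sum_add_distrib]
  ring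

/-- The powers of `p` in the coefficient are absorbed by the powers of `p` in the entries. What
survives is the part at `c = 0` supported on entries prime to `p`. -/
theorem primeD_primeS {n : ℕ} (F : ℕ → (ℕ → ℕ+) → k) (hF : DependsOnFirst (n + 1) (F 0))
    (c : ℕ) (m : ℕ → ℕ+) :
    primeD p n (primeS p n F) c m + primeS p (n + 1) (primeD p (n + 1) F) c m =
      F c m - if c = 0 ∧ pexp p (weight (n + 1) m) = 0 then F 0 m else 0 := by
  have key := sum_homotopy n (k := k)
    (fun i j => if (j = 0 → pfree p (homotopySeq p i c m 0) = 1) ∧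
      (j = n + 1 + 1 → homotopySeq p i c m (n + 1) = 1) then
      F (if j = 0 then 0 + pexp p (homotopySeq p i c m 0) else 0)
        (seqFace j (homotopySeq p i c m)) else 0)
    (fun i j => if (j = 0 → pfree p (m 0) = 1) ∧ (j = n + 1 → m n = 1) then
      F 0 (homotopySeq p i (if j = 0 then c + pexp p (m 0) else c) (seqFace j m)) else 0)
    ?_ ?_ ?_
  · convert key using 2
    · rw [primeD]
      refine Finset.sum_congr rfl fun j _ => ?_
      by_cases h : (j = 0 → pfree p (m 0) = 1) ∧ (j = n + 1 → m n = 1)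
      · simp only [if_pos h]
        rw [primeS, Finset.mul_sum]
        refine Finset.sum_congr rfl fun i _ => ?_
        ring
      · simp only [if_neg h, mul_zero, Finset.sum_const_zero]
    · rw [primeS]
      refine Finset.sum_congr rfl fun i _ => ?_
      rw [primeD, Finset.mul_sum]
      refine Finset.sum_congr rfl fun j _ => ?_
      ring
    -- First end: `p ^ c` is put in front of `m` and face `0` returns it to the coefficient, so the
    -- term is `F c m`.
    · have h1 : homotopySeq p 0 c m 0 = (p : ℕ+) ^ c := by simp [homotopySeq, weight]
      rw [h1]
      have h2 : seqFace 0 (homotopySeq p 0 c m) = m := by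
        ext1 x
        simp [seqFace, homotopySeq]
      simp [h2]
    -- Last end: the last face requires the collected power of `p` to be `1`, which forces `c = 0`
    -- and entries prime to `p`.
    · have h1 : homotopySeq p (n + 1) c m (n + 1) =
          (p : ℕ+) ^ (c + pexp p (weight (n + 1) m)) := by
        simp [homotopySeq]
      have h2 : (p : ℕ+) ^ (c + pexp p (weight (n + 1) m)) = 1 ↔
          c = 0 ∧ pexp p (weight (n + 1) m) = 0 := by
        rw [eq_one_iff_pfree p]
        simp
      simp only [h1, h2]
      simp only [Nat.add_eq_zero_iff, and_false, false_imp_iff, true_and,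
        OfNat.ofNat_ne_zero, if_false, true_imp_iff]
      by_cases h3 : c = 0 ∧ pexp p (weight (n + 1) m) = 0
      · rw [if_pos h3, if_pos (by simpa using h3)]
        refine hF _ _ fun x hx => ?_
        have h4 : pexp p (m x) = 0 := by
          have h5 : m x ∣ weight (n + 1) m :=
            Finset.dvd_prod_of_mem m (Finset.mem_range.2 hx)
          obtain ⟨y, hy⟩ := h5
          have := h3.2
          rw [hy, pexp_mul] at this
          omega
        simp [seqFace, homotopySeq, hx, pfree_eq_self p h4]
      · rw [if_neg h3, if_neg (by simpa using h3)]
  · intro i hi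
    have h1 : ¬ i + 1 = n + 1 + 1 := by omega
    simp only [h1, seqFace_homotopySeq_diag, Nat.add_eq_zero_iff, one_ne_zero, and_false,
      false_imp_iff, true_and, if_false, if_true]
  · intro i hi j hj
    have h1 : ¬ j = n + 1 + 1 := by omega
    have h2 : ¬ j = n + 1 := by omega
    simp only [h1, h2, seqFace_homotopySeq_of_le p hj, false_imp_iff, and_true]
    by_cases h : j = 0
    · simp [h, homotopySeq]
    · simp [h]
  · intro j hj i hij
    have h1 : ¬ j = 0 := by omega
    simp only [seqFace_homotopySeq_of_lt p hij, h1, Nat.add_eq_zero_iff, one_ne_zero, and_false,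
      false_imp_iff, true_and, if_false, add_left_inj]
    have h2 : homotopySeq p i c m (n + 1) = m n := by
      rw [homotopySeq, if_neg (by omega), if_neg (by omega), Nat.add_sub_cancel]
    rw [h2]

end Complex

end Dirichlet

namespace Dirichlet

/-! ### Splitting off a prime from a cocycle -/

section Splitting

variable {k : Type*} [Field k] (p : Nat.Primes) {n : ℕ}

theorem weight_seqFace_of_condition {j : ℕ} {m : ℕ → ℕ+} (hj : j ∈ Finset.range (n + 2))
    (h0 : j ≠ 0) (h : j = n + 1 → m n = 1) : weight n (seqFace j m) = weight (n + 1) m := by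
  rw [Finset.mem_range] at hj
  rcases eq_or_ne j (n + 1) with rfl | hjn
  · rw [weight_seqFace_of_lt m (Nat.lt_succ_self n), weight_succ, h rfl, mul_one]
  · exact weight_seqFace m h0 (by omega)

/-- The insertion only redistributes prime factors. This is why the homotopy keeps finite support,
and so continuity. -/
theorem weight_homotopySeq {i : ℕ} (h : i ≤ n) (c : ℕ) (m : ℕ → ℕ+) :
    weight (n + 1) (homotopySeq p i c m) = (p : ℕ+) ^ c * weight n m := by
  induction n, h using Nat.le_induction with
  | base =>
    have h1 : homotopySeq p i c m i = (p : ℕ+) ^ (c + pexp p (weight i m)) := by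
      simp [homotopySeq]
    have h2 : ∀ x < i, homotopySeq p i c m x = pfree p (m x) := fun x hx => if_pos hx
    have h3 : ∀ l, ∏ x ∈ Finset.range l, pfree p (m x) = pfree p (weight l m) := by
      intro l
      induction l with
      | zero => exact (pfree_eq_self p (pexp_one p)).symm
      | succ l ih => rw [Finset.prod_range_succ, ih, weight_succ, pfree_mul]
    rw [weight_succ, h1, weight_congr h2, weight, h3, pow_add, mul_left_comm,
      mul_comm (pfree _ _), pow_pexp_mul_pfree]
  | succ l hl ih =>
    rw [weight_succ, ih, weight_succ, mul_assoc]
    congr 2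
    rw [homotopySeq, if_neg (by omega), if_neg (by omega), Nat.add_sub_cancel]

/-- The analogue of bounded weight for functions with coefficients. -/
def FamilyBounded (n : ℕ) (F : ℕ → (ℕ → ℕ+) → k) : Prop :=
  ∃ N : ℕ+, ∀ c m, F c m ≠ 0 → (p : ℕ+) ^ c * weight n m ≤ N

variable {p}

/-! ### Permanence of the support bounds and of dependence on finitely many entries. -/

theorem FamilyBounded.boundedWeight {F : ℕ → (ℕ → ℕ+) → k} (h : FamilyBounded p n F) (c : ℕ) :
    BoundedWeight n (F c) := by
  obtain ⟨N, hN⟩ := h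
  exact ⟨N, fun m hm => (PNat.le_of_dvd (dvd_mul_left _ _)).trans (hN c m hm)⟩

theorem FamilyBounded.sub {F G : ℕ → (ℕ → ℕ+) → k} (hF : FamilyBounded p n F)
    (hG : FamilyBounded p n G) : FamilyBounded p n (F - G) := by
  obtain ⟨N, hN⟩ := hF
  obtain ⟨N', hN'⟩ := hG
  refine ⟨max N N', fun c m h => ?_⟩
  by_cases h1 : F c m = 0
  · refine (hN' c m fun h2 => h ?_).trans (le_max_right _ _)
    rw [Pi.sub_apply, Pi.sub_apply, h1, h2, sub_zero]
  · exact (hN c m h1).trans (le_max_left _ _)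

theorem FamilyBounded.shift {F : ℕ → (ℕ → ℕ+) → k} (hF : FamilyBounded p n F) :
    FamilyBounded p n fun c => F (c + 1) := by
  obtain ⟨N, hN⟩ := hF
  refine ⟨N, fun c m h => le_trans ?_ (hN _ m h)⟩
  rw [pow_succ', mul_assoc]
  exact PNat.le_of_dvd (dvd_mul_left _ _)

/-- Multiplication by `p` on the coefficients. -/
def raise (F : ℕ → (ℕ → ℕ+) → k) : ℕ → (ℕ → ℕ+) → k
  | 0 => 0
  | c + 1 => F c

theorem FamilyBounded.raise {F : ℕ → (ℕ → ℕ+) → k} (hF : FamilyBounded p n F) :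
    FamilyBounded p n (raise F) := by
  obtain ⟨N, hN⟩ := hF
  refine ⟨p * N, fun c m h => ?_⟩
  cases c with
  | zero => exact absurd rfl h
  | succ c =>
    rw [pow_succ', mul_assoc]
    exact mul_le_mul_right (hN c m h) _

theorem FamilyBounded.primeS {F : ℕ → (ℕ → ℕ+) → k} (hF : FamilyBounded p (n + 1) F) :
    FamilyBounded p n (primeS p n F) := by
  obtain ⟨N, hN⟩ := hF
  refine ⟨N, fun c m h => ?_⟩
  obtain ⟨i, hi, h1⟩ := Finset.exists_ne_zero_of_sum_ne_zero h
  have h2 := hN 0 _ (right_ne_zero_of_mul h1)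
  rw [Finset.mem_range] at hi
  rwa [pow_zero, one_mul, weight_homotopySeq p (by omega)] at h2

theorem FamilyBounded.primeD {F : ℕ → (ℕ → ℕ+) → k} (hF : FamilyBounded p n F) :
    FamilyBounded p (n + 1) (primeD p n F) := by
  obtain ⟨N, hN⟩ := hF
  refine ⟨N, fun c m h => ?_⟩
  obtain ⟨j, hj, h1⟩ := Finset.exists_ne_zero_of_sum_ne_zero h
  obtain ⟨h2, h3⟩ := ite_ne_right_iff.1 (right_ne_zero_of_mul h1)
  refine le_of_eq_of_le ?_ (hN _ _ h3)
  split_ifs with h0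
  · subst h0
    rw [weight_succ', pow_add, mul_assoc, ← eq_pow_of_pfree_eq_one p (h2.1 rfl)]
  · rw [weight_seqFace_of_condition hj h0 h2.2]

theorem dependsOnFirst_primeS {F : ℕ → (ℕ → ℕ+) → k} (hF : DependsOnFirst (n + 1) (F 0)) (c : ℕ) :
    DependsOnFirst n (primeS p n F c) := by
  intro m m' h
  refine Finset.sum_congr rfl fun i hi => ?_
  rw [Finset.mem_range] at hi
  congr 1
  refine hF _ _ fun x hx => ?_
  simp only [homotopySeq]
  rw [weight_congr fun y (hy : y < i) => h y (by omega)]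
  rcases lt_trichotomy x i with h1 | h1 | h1
  · rw [if_pos h1, if_pos h1, h x (by omega)]
  · simp [h1]
  · rw [if_neg (by omega), if_neg (by omega), if_neg (by omega), if_neg (by omega),
      h (x - 1) (by omega)]

theorem dependsOnFirst_primeD {F : ℕ → (ℕ → ℕ+) → k} (hF : ∀ c, DependsOnFirst n (F c)) (c : ℕ) :
    DependsOnFirst (n + 1) (primeD p n F c) := by
  intro m m' h
  refine Finset.sum_congr rfl fun j _ => ?_
  rw [h 0 (by omega), h n (by omega), hF _ _ _ (seqFace_congr h)]

theorem dependsOnFirst_raise {F : ℕ → (ℕ → ℕ+) → k} (hF : ∀ c, DependsOnFirst n (F c)) (c : ℕ) :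
    DependsOnFirst n (raise F c) := by
  cases c with
  | zero => exact fun _ _ _ => rfl
  | succ c => exact hF c

/-- The shift in `c` is a chain map. It serves for `G` with shift `F` as well as for `G = raise F`.
-/
theorem primeD_succ {F G : ℕ → (ℕ → ℕ+) → k} (h : ∀ c, G (c + 1) = F c) (c : ℕ) :
    primeD p n G (c + 1) = primeD p n F c := by
  funext m
  refine Finset.sum_congr rfl fun j _ => ?_
  have : (if j = 0 then c + 1 + pexp p (m 0) else c + 1) =
      (if j = 0 then c + pexp p (m 0) else c) + 1 := by
    split_ifs <;> omega
  rw [this, h]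

theorem primeD_sub (F G : ℕ → (ℕ → ℕ+) → k) :
    primeD p n (F - G) = primeD p n F - primeD p n G := by
  funext c m
  simp only [primeD, Pi.sub_apply, ← Finset.sum_sub_distrib, ← mul_sub]
  refine Finset.sum_congr rfl fun j _ => ?_
  split_ifs <;> simp

/-- The original complex is a subcomplex: `c + pexp p (m 0) = 0` with `m 0` a power of `p` forces `c
= 0` and `m 0 = 1`. -/
theorem primeD_single (f : (ℕ → ℕ+) → k) (c : ℕ) (m : ℕ → ℕ+) :
    primeD p n (fun c m => if c = 0 then f m else 0) c m = if c = 0 then seqD n f m else 0 := by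
  rw [primeD, seqD, ← mul_boole, Finset.sum_mul]
  refine Finset.sum_congr rfl fun j _ => ?_
  rw [mul_assoc]
  congr 1
  by_cases hj : j = 0
  · subst hj
    simp only [true_imp_iff, if_true, eq_one_iff_pfree p (m := m 0), Nat.add_eq_zero_iff]
    by_cases h1 : pfree p (m 0) = 1 <;> by_cases h2 : pexp p (m 0) = 0 <;>
      by_cases h3 : c = 0 <;> simp [h1, h2, h3]
  · by_cases h1 : j = n + 1 → m n = 1 <;> by_cases h3 : c = 0 <;> simp [h1, h3, hj]

/-- With only the coefficients `c = 0, 1` present, face `0` sees `m 0 = 1`, which belongs to `seqD`,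
or `m 0 = p`, which is the cup product with the prime cocycle. -/
theorem primeD_zero_apply {F : ℕ → (ℕ → ℕ+) → k} (h : ∀ c m, F (c + 2) m = 0) (m : ℕ → ℕ+) :
    primeD p n F 0 m = seqD n (F 0) m + if m 0 = p then F 1 (seqFace 0 m) else 0 := by
  rw [primeD, seqD, Finset.sum_range_succ', Finset.sum_range_succ' _ (n + 1), add_assoc]
  congr 1
  · refine Finset.sum_congr rfl fun j _ => ?_
    simp
  · have h0 : ¬ 0 = n + 1 := by omega
    simp only [pow_zero, one_mul, true_imp_iff, h0, false_imp_iff, and_true, if_true, zero_add,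
      eq_prime_iff_pfree p, eq_one_iff_pfree p (m := m 0)]
    by_cases h1 : pfree p (m 0) = 1
    · simp only [h1, true_and, if_true]
      rcases h2 : pexp p (m 0) with _ | _ | c
      · simp
      · simp
      · simp [h]
    · simp [h1]

variable (p) in
/-- The restriction of a function to the sequences whose entries are prime to `p`. -/
def freePart (n : ℕ) (f : (ℕ → ℕ+) → k) (m : ℕ → ℕ+) : k :=
  if pexp p (weight n m) = 0 then f m else 0

theorem dependsOnFirst_freePart {f : (ℕ → ℕ+) → k} (hf : DependsOnFirst n f) :
    DependsOnFirst n (freePart p n f) := by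
  intro m m' h
  rw [freePart, freePart, weight_congr h, hf m m' h]

theorem boundedWeight_freePart {f : (ℕ → ℕ+) → k} (hf : BoundedWeight n f) :
    BoundedWeight n (freePart p n f) := by
  obtain ⟨N, hN⟩ := hf
  exact ⟨N, fun m hm => hN m (ite_ne_right_iff.1 hm).2⟩

/-- Every face that contributes to `seqD` preserves the weight, so the complex splits according to
weight. -/
theorem seqD_freePart (f : (ℕ → ℕ+) → k) :
    seqD n (freePart p n f) = freePart p (n + 1) (seqD n f) := by
  funext m
  rw [freePart, seqD, seqD, ← mul_boole, Finset.sum_mul]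
  refine Finset.sum_congr rfl fun j hj => ?_
  rw [mul_assoc]
  congr 1
  by_cases h : (j = 0 → m 0 = 1) ∧ (j = n + 1 → m n = 1)
  · have hw : weight n (seqFace j m) = weight (n + 1) m := by
      by_cases h0 : j = 0
      · rw [weight_succ', h.1 h0, h0, one_mul]
      · exact weight_seqFace_of_condition hj h0 h.2
    rw [if_pos h, if_pos h, freePart, hw, mul_boole]
  · rw [if_neg h, if_neg h, zero_mul]

/-- The shift of `G` is a cocycle, so by the homotopy it is cohomologous to one concentrated at
coefficient `0`. Lifting that coboundary through the shift confines `G` to `c ≤ 1`. -/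
theorem exists_correction {G : ℕ → (ℕ → ℕ+) → k} (hd : ∀ c, DependsOnFirst n (G c))
    (hb : FamilyBounded p n G) (hG : ∀ c, primeD p n G (c + 1) = 0) :
    ∃ G' : ℕ → (ℕ → ℕ+) → k, (∀ c, DependsOnFirst n (G' c)) ∧ FamilyBounded p n G' ∧
      primeD p n G' = primeD p n G ∧ ∀ c m, G' (c + 2) m = 0 := by
  have hH : primeD p n (fun c => G (c + 1)) = 0 := by
    funext c
    exact (primeD_succ (F := fun c => G (c + 1)) (fun _ => rfl) c).symm.trans (hG c)
  cases n with
  | zero =>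
    refine ⟨G, hd, hb, rfl, fun c m => ?_⟩
    -- In degree `0` there is no homotopy, but the cocycle condition at the entry `p ^ (c + 1) ≠ 1`
    -- says directly that `G (c + 2)` vanishes.
    have h1 := congrFun (congrFun hH 0) fun x => if x = 0 then (p : ℕ+) ^ (c + 1) else 1
    have h2 : (p : ℕ+) ≠ 1 := by
      rw [Ne, eq_one_iff_pfree p, ((eq_prime_iff_pfree p).1 rfl).2]
      simp
    simp [primeD, Finset.sum_range_succ, h2] at h1
    rw [← h1]
    exact hd _ _ _ fun x hx => absurd hx (Nat.not_lt_zero x)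
  | succ n =>
    have hK := fun c m => primeD_primeS p (fun c => G (c + 1)) (hd 1) c m
    refine ⟨G - primeD p n (raise (primeS p n fun c => G (c + 1))), fun c m m' h => ?_,
      hb.sub hb.shift.primeS.raise.primeD, ?_, fun c m => ?_⟩
    · rw [Pi.sub_apply, Pi.sub_apply, Pi.sub_apply, hd c m m' h, dependsOnFirst_primeD
        (dependsOnFirst_raise (dependsOnFirst_primeS (hd 1))) c m m' h]
    · rw [primeD_sub, primeD_primeD, sub_zero]
    -- At positive coefficient the projection term of the homotopy formula is absent.
    · have h1 := hK (c + 1) m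
      have h2 : primeS p (n + 1) (0 : ℕ → (ℕ → ℕ+) → k) (c + 1) m = 0 :=
        Finset.sum_eq_zero fun _ _ => mul_zero _
      rw [hH, h2, add_zero, if_neg (by omega), sub_zero] at h1
      rw [Pi.sub_apply, Pi.sub_apply, primeD_succ (F := primeS p n fun c => G (c + 1)) (fun _ => rfl), h1, sub_self]

variable (p) in
-- Placed at `c = 0`, `f` becomes cohomologous to its part prime to `p`. A primitive of the
-- difference, confined to `c ≤ 1` by `exists_correction`, is read off at `c = 0`: its value at `0`
-- is `g`, its value at `1` is `h`.
theorem exists_splitting {f : (ℕ → ℕ+) → k} (hd : DependsOnFirst (n + 1) f)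
    (hb : BoundedWeight (n + 1) f) (hf : seqD (n + 1) f = 0) :
    ∃ g h : (ℕ → ℕ+) → k, DependsOnFirst n g ∧ BoundedWeight n g ∧ DependsOnFirst n h ∧
      BoundedWeight n h ∧ ∀ m, f m = freePart p (n + 1) f m + seqD n g m +
        if m 0 = p then h (seqFace 0 m) else 0 := by
  let F : ℕ → (ℕ → ℕ+) → k := fun c m => if c = 0 then f m else 0
  have hFd : ∀ c, DependsOnFirst (n + 1) (F c) := by
    intro c m m' h
    simp only [F, hd m m' h]
  have hFb : FamilyBounded p (n + 1) F := by
    obtain ⟨N, hN⟩ := hb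
    refine ⟨N, fun c m h => ?_⟩
    obtain ⟨rfl, h2⟩ := ite_ne_right_iff.1 h
    rw [pow_zero, one_mul]
    exact hN m h2
  have hG : ∀ c m, primeD p n (primeS p n F) c m =
      if c = 0 then f m - freePart p (n + 1) f m else 0 := by
    intro c m
    have h1 := primeD_primeS p F (hFd 0) c m
    have h2 : primeD p (n + 1) F = 0 := by
      funext c m
      rw [primeD_single, hf]
      simp
    have h3 : primeS p (n + 1) (0 : ℕ → (ℕ → ℕ+) → k) c m = 0 :=
      Finset.sum_eq_zero fun _ _ => mul_zero _
    rw [h2, h3, add_zero] at h1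
    rw [h1]
    by_cases hc : c = 0 <;> simp [F, freePart, hc]
  obtain ⟨G, hGd, hGb, hGD, hG2⟩ := exists_correction (dependsOnFirst_primeS (hFd 0)) hFb.primeS
    fun c => funext fun m => (hG (c + 1) m).trans (if_neg (Nat.succ_ne_zero c))
  refine ⟨G 0, G 1, hGd 0, hGb.boundedWeight 0, hGd 1, hGb.boundedWeight 1, fun m => ?_⟩
  have h1 := primeD_zero_apply (p := p) (n := n) hG2 m
  rw [hGD, hG, if_pos rfl] at h1
  rw [add_assoc, ← h1]
  ring

end Splitting

end Dirichlet

namespace Dirichlet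

open ContHochschild

/-! ### Values of cocycles -/

section Cocycles

set_option linter.unusedSectionVars false

variable {k : Type*} [Field k] [CharZero k] [TopologicalSpace k] [DiscreteTopology k] {n : ℕ}

theorem mem_cocycles_iff_val {f : Cochain k (dirichletAlgebra k) n} :
    f ∈ cocycles (augmentation k) n ↔ seqD n (val f) = 0 := by
  rw [cocycles, LinearMap.mem_ker, ← val_d]
  exact ⟨fun h => by rw [h]; rfl, fun h => val_injective (h.trans rfl)⟩

theorem val_coeffCochain_one (N : ℕ+) (m : ℕ → ℕ+) :
    val (coeffCochain k fun _ : Fin 1 => N) m = if m 0 = N then 1 else 0 := by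
  rw [val, coeffCochain_apply, Fin.prod_univ_one, coeff_mono]
  simp only [eq_comm, Fin.val_zero]

theorem seqD_one (φ : (ℕ → ℕ+) → k) (m : ℕ → ℕ+) :
    seqD 1 φ m = (if m 0 = 1 then φ (seqFace 0 m) else 0) - φ (seqFace 1 m)
      + if m 1 = 1 then φ (seqFace 2 m) else 0 := by
  simp [seqD, Finset.sum_range_succ, sub_eq_add_neg]

theorem seqD_one_val_coeffCochain (N : ℕ+) (m : ℕ → ℕ+) :
    seqD 1 (val (coeffCochain k fun _ : Fin 1 => N)) m =
      (if m 0 = 1 ∧ m 1 = N then 1 else 0) - (if m 0 * m 1 = N then 1 else 0)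
        + if m 1 = 1 ∧ m 0 = N then 1 else 0 := by
  have h0 : seqFace 0 m 0 = m 1 := rfl
  have h1 : seqFace 1 m 0 = m 0 * m 1 := rfl
  have h2 : seqFace 2 m 0 = m 0 := rfl
  simp only [seqD_one, val_coeffCochain_one, h0, h1, h2, ite_and]

theorem coe_prime_ne_one (p : Nat.Primes) : (p : ℕ+) ≠ 1 := by
  rw [Ne, eq_one_iff_pfree p, ((eq_prime_iff_pfree p).1 rfl).2]
  simp

theorem coe_prime_injective {p q : Nat.Primes} (h : (p : ℕ+) = q) : p = q :=
  Subtype.ext (congrArg PNat.val h)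

theorem mul_eq_prime_iff (p : Nat.Primes) (x y : ℕ+) :
    x * y = p ↔ x = 1 ∧ y = p ∨ x = p ∧ y = 1 := by
  constructor
  · intro h
    have h' : (x : ℕ) * y = p := congrArg PNat.val h
    rcases (Nat.dvd_prime p.2).1 ⟨_, h'.symm⟩ with h1 | h1
    · obtain rfl : x = 1 := PNat.eq h1
      exact Or.inl ⟨rfl, by simpa using h⟩
    · obtain rfl : x = p := PNat.eq h1
      exact Or.inr ⟨rfl, mul_left_cancel (h.trans (mul_one _).symm)⟩
  · rintro (⟨rfl, rfl⟩ | ⟨rfl, rfl⟩) <;> simp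

theorem mul_eq_prime_mul_prime_iff (p q : Nat.Primes) (x y : ℕ+) :
    x * y = p * q ↔ x = 1 ∧ y = p * q ∨ y = 1 ∧ x = p * q ∨ x = p ∧ y = q ∨ x = q ∧ y = p := by
  constructor
  · intro h
    have h' : (p : ℕ) ∣ x * y := ⟨q, congrArg PNat.val h⟩
    rcases (Nat.Prime.dvd_mul p.2).1 h' with h1 | h1
    · obtain ⟨z, rfl⟩ : (p : ℕ+) ∣ x := PNat.dvd_iff.2 h1
      rw [mul_assoc] at h
      rcases (mul_eq_prime_iff q z y).1 (mul_left_cancel h) with ⟨rfl, rfl⟩ | ⟨rfl, rfl⟩ <;> simp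
    · obtain ⟨z, rfl⟩ : (p : ℕ+) ∣ y := PNat.dvd_iff.2 h1
      rw [mul_left_comm] at h
      rcases (mul_eq_prime_iff q x z).1 (mul_left_cancel h) with ⟨rfl, rfl⟩ | ⟨rfl, rfl⟩ <;> simp
  · rintro (⟨rfl, rfl⟩ | ⟨rfl, rfl⟩ | ⟨rfl, rfl⟩ | ⟨rfl, rfl⟩) <;> simp [mul_comm]

variable (k) in
/-- The cocycle taking a formal Dirichlet series to its coefficient at a prime. -/
noncomputable def primeCocycle (p : Nat.Primes) : cocycles (augmentation k) 1 :=
  ⟨coeffCochain k fun _ => p, by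
    rw [mem_cocycles_iff_val]
    funext m
    rw [seqD_one_val_coeffCochain]
    simp only [mul_eq_prime_iff]
    have hp := coe_prime_ne_one p
    by_cases h1 : m 0 = 1 <;> by_cases h2 : m 1 = 1 <;> by_cases h3 : m 0 = p <;>
      by_cases h4 : m 1 = p <;> simp_all⟩

theorem primeCocycle_apply (p : Nat.Primes) (a : Fin 1 → dirichletAlgebra k) :
    (primeCocycle k p).1 a = coeff k p (a 0) := by
  refine (coeffCochain_apply _ a).trans ?_
  simp

/-- The class of the coefficient at a prime. -/
noncomputable def primeClass (k : Type*) [Field k] [CharZero k] [TopologicalSpace k]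
    [DiscreteTopology k] (p : Nat.Primes) : HHAlgebra (augmentation k) :=
  DirectSum.of (HH (augmentation k)) 1 (cls (augmentation k) 1 (primeCocycle k p))

/-- The factorizations of `p * q` without a factor `1` are `(p, q)` and `(q, p)`, so minus the
coboundary of the coefficient at `p * q` is supported on these. -/
theorem primeClass_mul_add (p q : Nat.Primes) :
    primeClass k p * primeClass k q + primeClass k q * primeClass k p = 0 := by
  rw [primeClass, primeClass, DirectSum.of_mul_of, DirectSum.of_mul_of, ← map_add]
  change DirectSum.of (HH (augmentation k)) (1 + 1) (cls _ _ (cupCocycles _ 1 1 _ _) +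
    cls _ _ (cupCocycles _ 1 1 _ _)) = 0
  rw [← map_add, (cls_eq_zero _).2, map_zero]
  -- For `p = q` the two products agree and their sum is `2` at `(p, p)`, while the coboundary has
  -- the value `-1` there.
  refine ⟨(if p = q then -2 else -1 : k) • coeffCochain k fun _ : Fin 1 => p * q,
    val_injective ?_⟩
  rw [map_smul]
  funext m
  change _ * val (d (augmentation k) 1 _) m = val (primeCocycle k p).1 m *
    val (primeCocycle k q).1 (seqFace 0 m) + val (primeCocycle k q).1 m *
    val (primeCocycle k p).1 (seqFace 0 m)
  rw [val_d, seqD_one_val_coeffCochain]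
  simp only [mul_eq_prime_mul_prime_iff]
  have e : ∀ (r : Nat.Primes) m, val (primeCocycle k r).1 m = if m 0 = r then 1 else 0 :=
    fun r m => val_coeffCochain_one _ m
  rw [e, e, e, e]
  have h0 : seqFace 0 m 0 = m 1 := rfl
  rw [h0]
  generalize m 0 = x, m 1 = y
  have hp := coe_prime_ne_one p
  have hq := coe_prime_ne_one q
  have hpq : (p : ℕ+) * q ≠ 1 := fun h => hp (pnat_mul_eq_one.1 h).1
  have hpp : (p : ℕ+) * q ≠ p := fun h => hq (mul_left_cancel (h.trans (mul_one _).symm))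
  have hqq : (p : ℕ+) * q ≠ q := fun h => hp (mul_right_cancel (h.trans (one_mul _).symm))
  by_cases h : p = q
  · subst h
    by_cases h1 : x = p
    · by_cases h2 : y = p
      · simp [h1, h2, hp, hpp.symm]
        norm_num
      · by_cases h3 : y = 1 <;> simp [h1, h2, h3, hp, hp.symm, hpp.symm]
    · by_cases h4 : x = 1
      · by_cases h3 : y = p * p <;> simp [h4, h3, hp.symm, hpp, hpq, hpq.symm]
      · by_cases h2 : y = 1 <;> by_cases h3 : x = p * p <;>
          simp [h1, h2, h3, h4, hp.symm, hpp, hpq, hpq.symm]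
  · have hne : (p : ℕ+) ≠ q := fun h' => h (coe_prime_injective h')
    rw [if_neg h]
    by_cases h1 : x = p
    · by_cases h2 : y = q <;> simp [h1, h2, hp, hpp.symm, hne]
    · by_cases h2 : x = q
      · by_cases h3 : y = p <;> simp [h2, h3, hq, hqq.symm, hne.symm]
      · by_cases h4 : x = 1
        · by_cases h3 : y = p * q <;> simp [h4, h3, hp.symm, hq.symm, hpq.symm]
        · by_cases h5 : y = 1 <;> by_cases h3 : x = p * q <;>
            simp [h1, h2, h3, h4, h5, hpq, hpp, hqq]

/-- The cup product lives in degree `1 + n`; this represents it in degree `n + 1`, as the inductions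
require. -/
theorem exists_one_mul (x : cocycles (augmentation k) 1) (z : cocycles (augmentation k) n) :
    ∃ w : cocycles (augmentation k) (n + 1),
      DirectSum.of (HH (augmentation k)) 1 (cls _ 1 x) * DirectSum.of _ n (cls _ n z) =
        DirectSum.of _ (n + 1) (cls _ (n + 1) w) ∧
      ∀ a, w.1 a = x.1 (fun _ => a 0) * z.1 (Fin.tail a) := by
  have key : ∀ N (h : 1 + n = N) (c : cocycles (augmentation k) (1 + n)),
      ∃ w : cocycles (augmentation k) N,
        DirectSum.of (HH (augmentation k)) (1 + n) (cls _ _ c) =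
          DirectSum.of (HH (augmentation k)) N (cls _ N w) ∧
        ∀ a, w.1 a = c.1 fun i => a (Fin.cast h i) := by
    rintro N rfl c
    exact ⟨c, rfl, fun _ => rfl⟩
  obtain ⟨w, h1, h2⟩ := key (n + 1) (add_comm 1 n) (cupCocycles (augmentation k) 1 n x z)
  refine ⟨w, (DirectSum.of_mul_of _ _).trans h1, fun a => (h2 a).trans ?_⟩
  change x.1 _ * z.1 _ = _
  congr 2
  · funext i
    rw [Subsingleton.elim i 0]
    rfl
  · funext i
    exact congrArg a (Fin.ext (add_comm 1 (i : ℕ)))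

end Cocycles

/-! ### The homomorphism from the exterior algebra -/

section Generation

set_option linter.unusedSectionVars false

variable (k : Type*) [Field k] [CharZero k] [TopologicalSpace k] [DiscreteTopology k] {n : ℕ}

/-- An enumeration of the primes. -/
noncomputable def primeEquiv : ℕ ≃ Nat.Primes := Classical.choice nonempty_equiv_of_countable

/-- The linear combinations of the classes of primes. -/
noncomputable def primeCombination : (ℕ →₀ k) →ₗ[k] HHAlgebra (augmentation k) :=
  Finsupp.linearCombination k fun i => primeClass k (primeEquiv i)

theorem primeCombination_single (i : ℕ) :
    primeCombination k (Finsupp.single i 1) = primeClass k (primeEquiv i) := by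
  simp [primeCombination]

theorem primeCombination_mul_self (v : ℕ →₀ k) :
    primeCombination k v * primeCombination k v = 0 := by
  have : IsScalarTower k (HHAlgebra (augmentation k)) (HHAlgebra (augmentation k)) :=
    @IsScalarTower.right k (HHAlgebra (augmentation k)) _ _ _
  have : SMulCommClass k (HHAlgebra (augmentation k)) (HHAlgebra (augmentation k)) :=
    @Algebra.to_smulCommClass k (HHAlgebra (augmentation k)) _ _ _
  have h : ∀ u w : ℕ →₀ k, primeCombination k u * primeCombination k w +
      primeCombination k w * primeCombination k u = 0 := by
    intro u w
    have h1 : (LinearMap.mul k (HHAlgebra (augmentation k))).compl₁₂ (primeCombination k)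
        (primeCombination k) + ((LinearMap.mul k (HHAlgebra (augmentation k))).compl₁₂
        (primeCombination k) (primeCombination k)).flip = 0 := by
      refine Finsupp.lhom_ext' fun i => LinearMap.ext_ring (Finsupp.lhom_ext' fun j =>
        LinearMap.ext_ring ?_)
      simpa [primeCombination_single] using primeClass_mul_add (k := k) (primeEquiv i) (primeEquiv j)
    exact LinearMap.congr_fun₂ h1 u w
  have h2 := h v v
  -- Anticommutation gives twice the square; characteristic `0` allows division by `2`.
  rw [← two_smul k, smul_eq_zero] at h2
  exact h2.resolve_left two_ne_zero

/-- The homomorphism from the exterior algebra given by the classes of primes. -/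
noncomputable def fromExterior : ExteriorAlgebra k (ℕ →₀ k) →ₐ[k] HHAlgebra (augmentation k) :=
  ExteriorAlgebra.lift k ⟨primeCombination k, primeCombination_mul_self k⟩

theorem fromExterior_ι (i : ℕ) :
    fromExterior k (ExteriorAlgebra.ι k (Finsupp.single i 1)) = primeClass k (primeEquiv i) := by
  rw [fromExterior, ExteriorAlgebra.lift_ι_apply, primeCombination_single]

/-! ### Surjectivity: cocycles are combinations of products of prime classes. -/

variable {k}

/-- The Leibniz rule at a sequence starting with `q`. Face `0` drops out since `q ≠ 1`, and face `1`
survives only if `m 1 = 1`, which makes it face `0` of the rest. -/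
theorem seqD_prime_mul (q : Nat.Primes) (h : (ℕ → ℕ+) → k) {m : ℕ → ℕ+} (hm : m 0 = q) :
    seqD (n + 1) (fun m => if m 0 = q then h (seqFace 0 m) else 0) m =
      -seqD n h (seqFace 0 m) := by
  rw [seqD, Finset.sum_range_succ', seqD, ← Finset.sum_neg_distrib]
  have hq := coe_prime_ne_one q
  rw [if_neg (fun h => hq (hm ▸ h.1 rfl)), mul_zero, add_zero]
  refine Finset.sum_congr rfl fun j _ => ?_
  rw [pow_succ, mul_neg_one, neg_mul]
  congr 2
  rw [seqFace_seqFace m (Nat.zero_le j)]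
  have e1 : seqFace 0 m 0 = m 1 := rfl
  have e2 : seqFace 0 m n = m (n + 1) := rfl
  rw [e1, e2]
  by_cases hj : j = 0
  · subst hj
    have e3 : seqFace (0 + 1) m 0 = q * m 1 := by
      rw [← hm]
      rfl
    have e4 : (q : ℕ+) * m 1 = q ↔ m 1 = 1 := by
      rw [mul_eq_left]
    simp [e3, e4]
  · have e3 : seqFace (j + 1) m 0 = q := (if_pos (by omega)).trans hm
    simp [e3, hj]

theorem weight_eq_one_iff {m : ℕ → ℕ+} : weight n m = 1 ↔ ∀ x < n, m x = 1 := by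
  constructor
  · intro h x hx
    exact le_antisymm ((le_weight hx).trans h.le) one_le
  · intro h
    exact Finset.prod_eq_one fun x hx => h x (Finset.mem_range.1 hx)

/-- On the constant tuple `1` all `n + 2` faces agree, so the differential is an alternating sum of
ones. -/
theorem seqD_weight_one (c : k) (m : ℕ → ℕ+) :
    seqD n (fun m => if weight n m = 1 then c else 0) m =
      if weight (n + 1) m = 1 then (if Even n then 0 else c) else 0 := by
  have h : ∀ j ∈ Finset.range (n + 2),
      (-1 : k) ^ j * (if (j = 0 → m 0 = 1) ∧ (j = n + 1 → m n = 1) then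
        (if weight n (seqFace j m) = 1 then c else 0) else 0) =
      (-1 : k) ^ j * if weight (n + 1) m = 1 then c else 0 := by
    intro j hj
    congr 1
    by_cases hok : (j = 0 → m 0 = 1) ∧ (j = n + 1 → m n = 1)
    · rw [if_pos hok]
      congr 2
      by_cases h0 : j = 0
      · rw [weight_succ', hok.1 h0, h0, one_mul]
      · rw [weight_seqFace_of_condition hj h0 hok.2]
    · rw [if_neg hok, if_neg]
      intro hw
      rw [weight_eq_one_iff] at hw
      exact hok ⟨fun _ => hw 0 (by omega), fun _ => hw n (by omega)⟩
  rw [seqD, Finset.sum_congr rfl h, ← Finset.sum_mul, neg_one_geom_sum]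
  by_cases hn : Even n <;> simp [hn, Nat.even_add]

/-- The part of weight `1` is a copy of `k` in each degree with differentials alternately zero and
the identity, hence acyclic in positive degrees. For `n` even the cocycle is zero, for `n` odd it is
a coboundary. -/
theorem cls_eq_zero_of_weight_one (z : cocycles (augmentation k) (n + 1))
    (hz : ∀ m, val z.1 m ≠ 0 → weight (n + 1) m = 1) : cls (augmentation k) (n + 1) z = 0 := by
  obtain ⟨c, hc⟩ : ∃ c, val z.1 = fun m => if weight (n + 1) m = 1 then c else 0 := by
    refine ⟨val z.1 1, funext fun m => ?_⟩
    by_cases h : weight (n + 1) m = 1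
    · rw [if_pos h]
      exact dependsOnFirst_val z.1 _ _ (weight_eq_one_iff.1 h)
    · rw [if_neg h]
      by_contra hne
      exact h (hz m hne)
  have h0 := mem_cocycles_iff_val.1 z.2
  rw [cls_eq_zero]
  by_cases hn : Even n
  · have h1 := congrFun h0 1
    rw [hc, seqD_weight_one, if_pos ((weight_eq_one_iff (m := 1)).2 fun _ _ => rfl),
      if_neg (Nat.not_even_iff_odd.2 hn.add_one)] at h1
    have h2 : z.1 = 0 := val_injective (by
      rw [hc, h1]
      funext m
      exact ite_self _)
    rw [h2]
    exact Submodule.zero_mem _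
  · obtain ⟨b, hb⟩ := exists_val_eq (k := k) (n := n)
      (φ := fun m => if weight n m = 1 then c else 0)
      (fun m m' h => by simp only [weight_congr h])
      ⟨1, fun m h => (ite_ne_right_iff.1 h).1.le⟩
    refine ⟨b, val_injective ?_⟩
    rw [val_d, hb, hc]
    funext m
    rw [seqD_weight_one, if_neg hn]

/-- The splitting of functions passes to cohomology once the cofactor is seen to be a cocycle, which
the Leibniz rule gives. -/
theorem exists_cocycle_splitting (q : Nat.Primes) (z : cocycles (augmentation k) (n + 1)) :
    ∃ (z' : cocycles (augmentation k) (n + 1)) (y : cocycles (augmentation k) n),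
      val z'.1 = freePart q (n + 1) (val z.1) ∧
      DirectSum.of (HH (augmentation k)) (n + 1) (cls _ _ z) =
        DirectSum.of (HH (augmentation k)) (n + 1) (cls _ _ z') +
          primeClass k q * DirectSum.of (HH (augmentation k)) n (cls _ _ y) := by
  obtain ⟨g, h, hg1, hg2, hh1, hh2, H⟩ := exists_splitting q (dependsOnFirst_val z.1)
    (boundedWeight_val z.1) (mem_cocycles_iff_val.1 z.2)
  obtain ⟨z', hz'⟩ := exists_val_eq (dependsOnFirst_freePart (p := q) (dependsOnFirst_val z.1))
    (boundedWeight_freePart (p := q) (boundedWeight_val z.1))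
  obtain ⟨b, rfl⟩ := exists_val_eq hg1 hg2
  obtain ⟨y, rfl⟩ := exists_val_eq hh1 hh2
  have hz'c : z' ∈ cocycles (augmentation k) (n + 1) := by
    rw [mem_cocycles_iff_val, hz', seqD_freePart, mem_cocycles_iff_val.1 z.2]
    funext m
    exact ite_self _
  have hdiff : val (z.1 - z' - d (augmentation k) n b) =
      fun m : ℕ → ℕ+ => if m 0 = q then val y (seqFace 0 m) else 0 := by
    funext m
    change val z.1 m - val z' m - val (d (augmentation k) n b) m = _
    rw [H m, hz', val_d]
    ring
  have hyc : y ∈ cocycles (augmentation k) n := by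
    have h1 : z.1 - z' - d (augmentation k) n b ∈ cocycles (augmentation k) (n + 1) :=
      Submodule.sub_mem _ (Submodule.sub_mem _ z.2 hz'c)
        (coboundaries_le_cocycles _ (n + 1) ⟨b, rfl⟩)
    rw [mem_cocycles_iff_val, hdiff] at h1
    rw [mem_cocycles_iff_val]
    funext m
    -- Putting `q` in front of an arbitrary sequence; face `0` recovers `m`.
    have h2 := congrFun h1 fun x => if x = 0 then q else m (x - 1)
    rw [seqD_prime_mul q _ (if_pos rfl)] at h2
    exact neg_eq_zero.1 h2
  obtain ⟨w, hw1, hw2⟩ := exists_one_mul (primeCocycle k q) ⟨y, hyc⟩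
  refine ⟨⟨z', hz'c⟩, ⟨y, hyc⟩, hz', ?_⟩
  rw [primeClass, hw1, ← map_add, ← map_add, ← sub_eq_zero, ← map_sub, ← map_sub,
    (cls_eq_zero _).2, map_zero]
  refine ⟨b, val_injective ?_⟩
  funext m
  have h1 := congrFun hdiff m
  have h2 : val w.1 m = if m 0 = q then val y (seqFace 0 m) else 0 := by
    refine (hw2 _).trans ?_
    rw [primeCocycle_apply, coeff_mono]
    simp only [eq_comm (a := (q : ℕ+)), Fin.val_zero, ite_mul, one_mul, zero_mul]
    rfl
  change _ = val z.1 m - (val z' m + val w.1 m)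
  rw [h2, ← h1]
  change _ = val z.1 m - (val z' m + (val z.1 m - val z' m - val (d (augmentation k) n b) m))
  ring

theorem exists_fromExterior_eq : ∀ (n : ℕ) (z : cocycles (augmentation k) n),
    ∃ y ∈ ⋀[k]^n (ℕ →₀ k), fromExterior k y =
      DirectSum.of (HH (augmentation k)) n (cls _ n z) := by
  intro n
  induction n with
  | zero =>
    intro z
    -- A cochain of degree `0` is a scalar, its value on the empty tuple.
    refine ⟨algebraMap k _ (z.1 default), ?_, ?_⟩
    · rw [ExteriorAlgebra.exteriorPower, pow_zero]
      exact Submodule.algebraMap_mem _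
    · rw [AlgHom.commutes]
      change DirectSum.of (HH (augmentation k)) 0 (z.1 default • cls _ 0 (oneCocycle _)) = _
      rw [← map_smul]
      congr 2
      refine Subtype.ext (Cochain.ext fun a => ?_)
      rw [Subsingleton.elim a default]
      exact mul_one _
  | succ n ih =>
    -- `S` contains every prime that divides some weight in the support of `z`. Splitting at `q`
    -- removes `q` from this set, at the cost of a product with a cocycle of degree `n`, to which
    -- `ih` applies.
    have main : ∀ (S : Finset Nat.Primes) (z : cocycles (augmentation k) (n + 1)),
        (∀ m, val z.1 m ≠ 0 → ∀ q ∉ S, pexp q (weight (n + 1) m) = 0) →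
        ∃ y ∈ ⋀[k]^(n + 1) (ℕ →₀ k), fromExterior k y =
          DirectSum.of (HH (augmentation k)) (n + 1) (cls _ (n + 1) z) := by
      intro S
      induction S using Finset.induction_on with
      | empty =>
        intro z hz
        refine ⟨0, Submodule.zero_mem _, ?_⟩
        rw [cls_eq_zero_of_weight_one z, map_zero, map_zero]
        exact fun m hm => eq_one_of_pexp fun q => hz m hm q (Finset.notMem_empty q)
      | insert q S _ ihS =>
        intro z hz
        obtain ⟨z', y, hz', h⟩ := exists_cocycle_splitting q z
        obtain ⟨u, hu, hu'⟩ := ihS z' (by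
          intro m hm r hr
          rw [hz', freePart, ite_ne_right_iff] at hm
          rcases eq_or_ne r q with rfl | hrq
          · exact hm.1
          · exact hz m hm.2 r (by simp [hrq, hr]))
        obtain ⟨v, hv, hv'⟩ := ih y
        refine ⟨u + ExteriorAlgebra.ι k (Finsupp.single (primeEquiv.symm q) 1) * v,
          Submodule.add_mem _ hu ?_, ?_⟩
        · rw [ExteriorAlgebra.exteriorPower, pow_succ']
          exact Submodule.mul_mem_mul (LinearMap.mem_range_self _ _) hv
        · rw [h, map_add, map_mul, fromExterior_ι, Equiv.apply_symm_apply, hu', hv']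
    intro z
    obtain ⟨N, hN⟩ := boundedWeight_val z.1
    -- The support has weight at most `N`, so only primes up to `N` can occur.
    have hfin : {q : Nat.Primes | (q : ℕ) ≤ N}.Finite :=
      (Set.finite_Iic (N : ℕ)).preimage Subtype.val_injective.injOn
    refine main hfin.toFinset z fun m hm q hq => ?_
    refine Nat.factorization_eq_zero_of_not_dvd fun hdvd => hq ?_
    rw [Set.Finite.mem_toFinset]
    exact (Nat.le_of_dvd (weight (n + 1) m).2 hdvd).trans (hN m hm)

end Generation

end Dirichlet

namespace Dirichlet

open ContHochschild

/-! ### Antisymmetrization detects the exterior algebra -/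

section Injectivity

set_option linter.unusedSectionVars false

variable {k : Type*} [Field k] [CharZero k] [TopologicalSpace k] [DiscreteTopology k] {n : ℕ}

variable (k) in
/-- The antisymmetrized value of a cochain at a tuple of monomials. -/
noncomputable def altValue (t : Fin n → ℕ+) : Cochain k (dirichletAlgebra k) n →ₗ[k] k where
  toFun f := ∑ σ : Equiv.Perm (Fin n), ((Equiv.Perm.sign σ : ℤ) : k) * f fun i => mono k (t (σ i))
  map_add' f g := by simp [mul_add, Finset.sum_add_distrib]
  map_smul' c f := by simp [Finset.mul_sum, mul_left_comm]

theorem altValue_apply (t : Fin n → ℕ+) (f : Cochain k (dirichletAlgebra k) n) :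
    altValue k t f = ∑ σ : Equiv.Perm (Fin n),
      ((Equiv.Perm.sign σ : ℤ) : k) * f fun i => mono k (t (σ i)) := rfl

theorem contractNth_comp_swap {M : Type*} [CommMagma M] (j : Fin n) (g : Fin (n + 1) → M) :
    Fin.contractNth j.castSucc (· * ·) (fun i => g (Equiv.swap j.castSucc j.succ i)) =
      Fin.contractNth j.castSucc (· * ·) g := by
  funext i
  rcases lt_trichotomy (i : ℕ) (j : ℕ) with h | h | h
  · rw [Fin.contractNth_apply_of_lt _ _ _ _ h, Fin.contractNth_apply_of_lt _ _ _ _ h,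
      Equiv.swap_apply_of_ne_of_ne]
    · exact fun h' => h.ne (congrArg Fin.val (Fin.castSucc_injective _ h'))
    · intro h'
      have := congrArg Fin.val h'
      simp at this
      omega
  · obtain rfl : i = j := Fin.ext h
    rw [Fin.contractNth_apply_of_eq _ _ _ _ rfl, Fin.contractNth_apply_of_eq _ _ _ _ rfl,
      Equiv.swap_apply_left, Equiv.swap_apply_right, mul_comm]
  · rw [Fin.contractNth_apply_of_gt _ _ _ _ h, Fin.contractNth_apply_of_gt _ _ _ _ h,
      Equiv.swap_apply_of_ne_of_ne]
    · intro h'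
      have := congrArg Fin.val h'
      simp at this
      omega
    · exact fun h' => h.ne' (congrArg Fin.val (Fin.succ_injective _ h'))

theorem contractNth_mono (j : Fin n) (u : Fin (n + 1) → ℕ+) :
    Fin.contractNth j.castSucc (· * ·) (fun i => mono k (u i)) =
      fun i => mono k (Fin.contractNth j.castSucc (· * ·) u i) := by
  funext i
  simp only [Fin.contractNth, mono_mul_mono]
  split_ifs <;> rfl

/-- The outer faces vanish because the augmentation kills monomials other than `1`. An inner face is
unchanged by swapping the two entries it multiplies, whereas the sign changes. -/
theorem altValue_d (t : Fin (n + 1) → ℕ+) (ht : ∀ i, t i ≠ 1)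
    (b : Cochain k (dirichletAlgebra k) n) : altValue k t (d (augmentation k) n b) = 0 := by
  have h : ∀ σ : Equiv.Perm (Fin (n + 1)), d (augmentation k) n b (fun i => mono k (t (σ i))) =
      ∑ j : Fin n, (-1 : k) ^ ((j : ℕ) + 1) *
        b fun i => mono k (Fin.contractNth j.castSucc (· * ·) (fun i => t (σ i)) i) := by
    intro σ
    rw [d_apply]
    simp only [augmentation_mono, ht, if_false, zero_mul, mul_zero, zero_add, add_zero,
      contractNth_mono _ fun i => t (σ i)]
  rw [altValue_apply]
  simp only [h, Finset.mul_sum]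
  rw [Finset.sum_comm]
  refine Finset.sum_eq_zero fun j _ => ?_
  -- It suffices that the sum equals its negative; reindexing by the transposition of `j` and `j +
  -- 1` shows this.
  rw [← self_eq_neg, ← Finset.sum_neg_distrib]
  refine Fintype.sum_equiv (Equiv.mulRight (Equiv.swap j.castSucc j.succ)) _ _ fun σ => ?_
  have hs : Equiv.Perm.sign (Equiv.swap j.castSucc j.succ) = -1 :=
    Equiv.Perm.sign_swap (Fin.castSucc_lt_succ).ne
  have hc := contractNth_comp_swap j fun i => t (σ i)
  simp only [Equiv.coe_mulRight, Equiv.Perm.sign_mul, hs, Equiv.Perm.mul_apply, hc]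
  simp

theorem altValue_eq_zero_of_mem_coboundaries (t : Fin n → ℕ+) (ht : ∀ i, t i ≠ 1)
    {f : Cochain k (dirichletAlgebra k) n} (hf : f ∈ coboundaries (augmentation k) n) :
    altValue k t f = 0 := by
  cases n with
  | zero =>
    obtain rfl : f = 0 := hf
    exact map_zero _
  | succ n =>
    obtain ⟨b, rfl⟩ := hf
    exact altValue_d t ht b

variable (k) in
/-- The antisymmetrized value of a cohomology class at a tuple of monomials different from `1`. -/
noncomputable def altClass (t : Fin n → ℕ+) (ht : ∀ i, t i ≠ 1) :
    HH (augmentation k) n →ₗ[k] k :=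
  ((coboundaries (augmentation k) n).submoduleOf (cocycles (augmentation k) n)).liftQ
    (altValue k t ∘ₗ (cocycles (augmentation k) n).subtype)
    fun _ hf => altValue_eq_zero_of_mem_coboundaries t ht hf

theorem altClass_cls (t : Fin n → ℕ+) (ht : ∀ i, t i ≠ 1) (z : cocycles (augmentation k) n) :
    altClass k t ht (cls _ n z) = altValue k t z.1 := rfl

/-- An explicit cocycle for each product of generators, so that the alternating functionals can be
evaluated on it. -/
theorem fromExterior_ιMulti : ∀ (n : ℕ) (u : Fin n → ℕ), ∃ w : cocycles (augmentation k) n,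
    fromExterior k (ExteriorAlgebra.ιMulti k n fun i => Finsupp.single (u i) 1) =
      DirectSum.of (HH (augmentation k)) n (cls _ n w) ∧
    ∀ a, w.1 a = ∏ i, coeff k (primeEquiv (u i)) (a i) := by
  intro n
  induction n with
  | zero =>
    intro u
    refine ⟨oneCocycle _, ?_, fun a => ?_⟩
    · rw [ExteriorAlgebra.ιMulti_zero_apply, map_one]
      rfl
    · rw [oneCocycle_apply]
      rfl
  | succ n ih =>
    intro u
    obtain ⟨w, hw1, hw2⟩ := ih fun i => u i.succ
    obtain ⟨v, hv1, hv2⟩ := exists_one_mul (primeCocycle k (primeEquiv (u 0))) w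
    refine ⟨v, ?_, fun a => ?_⟩
    · rw [ExteriorAlgebra.ιMulti_succ_apply, map_mul, fromExterior_ι, ← hv1, ← hw1]
      rfl
    · rw [hv2, hw2, primeCocycle_apply, Fin.prod_univ_succ]
      rfl

/-- The increasing enumeration of a finite set. -/
noncomputable def enumerate (s : Set.powersetCard ℕ n) : Fin n ↪o ℕ :=
  Set.powersetCard.ofFinEmbEquiv.symm s

/-- A permutation contributes only if it matches the two enumerations. Then the sets coincide, and
since the enumeration is injective the permutation is the identity. -/
theorem altValue_prod (s t : Set.powersetCard ℕ n) (f : Cochain k (dirichletAlgebra k) n)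
    (hf : ∀ a, f a = ∏ i, coeff k (primeEquiv (enumerate s i)) (a i)) :
    altValue k (fun i => (primeEquiv (enumerate t i) : ℕ+)) f = if s = t then 1 else 0 := by
  have h : ∀ σ : Equiv.Perm (Fin n),
      f (fun i => mono k (primeEquiv (enumerate t (σ i)))) =
        if ∀ i, enumerate s i = enumerate t (σ i) then 1 else 0 := by
    intro σ
    have h1 : ∀ x y : ℕ, ((primeEquiv x : ℕ+) = primeEquiv y) ↔ x = y := fun x y =>
      ⟨fun h => primeEquiv.injective (coe_prime_injective h), fun h => h ▸ rfl⟩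
    rw [hf]
    simp only [coeff_mono, h1]
    rw [Finset.prod_ite_zero]
    simp
  rw [altValue_apply]
  simp only [h]
  have hst : ∀ σ : Equiv.Perm (Fin n), (∀ i, enumerate s i = enumerate t (σ i)) → s = t := by
    intro σ hσ
    apply Set.powersetCard.ofFinEmbEquiv.symm.injective
    change enumerate s = enumerate t
    refine OrderEmbedding.range_inj.1 ?_
    rw [show (enumerate s : Fin n → ℕ) = enumerate t ∘ σ from funext hσ,
      σ.surjective.range_comp]
  split_ifs with hs
  · subst hs
    rw [Finset.sum_eq_single 1]
    · simp
    · intro σ _ hσ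
      rw [if_neg, mul_zero]
      intro h'
      exact hσ (Equiv.ext fun i => ((enumerate s).injective (h' i)).symm)
    · simp
  · refine Finset.sum_eq_zero fun σ _ => ?_
    rw [if_neg fun h' => hs (hst σ h'), mul_zero]

/-- Each coordinate in the standard basis of the exterior algebra factors through `fromExterior`, as
an alternating functional on the component of the relevant degree. -/
theorem fromExterior_injective : Function.Injective (fromExterior k) := by
  let b := (Finsupp.basisSingleOne (R := k) (ι := ℕ)).ExteriorAlgebra
  have hb : ∀ (s : Finset ℕ) (n : ℕ) (hn : s.card = n), ∃ w : cocycles (augmentation k) n,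
      fromExterior k (b s) = DirectSum.of (HH (augmentation k)) n (cls _ n w) ∧
      ∀ a, w.1 a = ∏ i,
        coeff k (primeEquiv (enumerate (Set.powersetCard.ofCard hn) i)) (a i) := by
    intro s n hn
    obtain ⟨w, h1, h2⟩ := fromExterior_ιMulti (k := k) n
      (enumerate (Set.powersetCard.ofCard hn))
    refine ⟨w, ?_, h2⟩
    rw [← h1, ExteriorAlgebra.basis_apply_ofCard _ hn, ExteriorAlgebra.ιMulti_family]
    congr 2
  have hcoord : ∀ (t : Finset ℕ) (y : ExteriorAlgebra k (ℕ →₀ k)), b.coord t y =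
      altClass k (fun i => (primeEquiv (enumerate (Set.powersetCard.ofCard (s := t) rfl) i) : ℕ+))
        (fun i => coe_prime_ne_one _) (DirectSum.component k ℕ (HH (augmentation k)) t.card
          (fromExterior k y)) := by
    intro t y
    let L : ExteriorAlgebra k (ℕ →₀ k) →ₗ[k] k :=
      (altClass k (fun i => (primeEquiv (enumerate (Set.powersetCard.ofCard (s := t) rfl) i) : ℕ+))
        fun i => coe_prime_ne_one _) ∘ₗ (DirectSum.component k ℕ (HH (augmentation k)) t.card) ∘ₗ
          (fromExterior k).toLinearMap
    have : b.coord t = L := by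
      refine b.ext fun s => ?_
      rw [Module.Basis.coord_apply, Module.Basis.repr_self, Finsupp.single_apply]
      change _ = altClass k _ (fun i => coe_prime_ne_one _) (DirectSum.component k ℕ (HH (augmentation k)) t.card
          (fromExterior k (b s)))
      by_cases hc : s.card = t.card
      · obtain ⟨w, h1, h2⟩ := hb s t.card hc
        have h3 : DirectSum.component k ℕ (HH (augmentation k)) t.card
            (DirectSum.of (HH (augmentation k)) t.card (cls _ t.card w)) = cls _ t.card w :=
          DirectSum.of_eq_same _ _
        rw [h1, h3, altClass_cls, altValue_prod _ _ _ h2]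
        have h4 : Set.powersetCard.ofCard hc = Set.powersetCard.ofCard (s := t) rfl ↔ s = t :=
          Subtype.ext_iff
        simp only [h4]
      · obtain ⟨w, h1, -⟩ := hb s s.card rfl
        have h3 : DirectSum.component k ℕ (HH (augmentation k)) t.card
            (DirectSum.of (HH (augmentation k)) s.card (cls _ s.card w)) = 0 :=
          DirectSum.of_eq_of_ne _ _ _ (Ne.symm hc)
        rw [h1, h3, map_zero, if_neg]
        rintro rfl
        exact hc rfl
    rw [this]
    rfl
  rw [injective_iff_map_eq_zero]
  intro y hy
  refine b.ext_elem fun t => ?_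
  rw [← Module.Basis.coord_apply, hcoord, hy, map_zero, map_zero, map_zero]
  rfl

theorem fromExterior_surjective : Function.Surjective (fromExterior k) := by
  intro x
  induction x using DirectSum.induction_on with
  | zero => exact ⟨0, map_zero _⟩
  | of n x =>
    obtain ⟨z, rfl⟩ := cls_surjective _ n x
    obtain ⟨y, -, hy⟩ := exists_fromExterior_eq n z
    exact ⟨y, hy⟩
  | add x y hx hy =>
    obtain ⟨u, rfl⟩ := hx
    obtain ⟨v, rfl⟩ := hy
    exact ⟨u + v, map_add _ _ _⟩

theorem fromExterior_mem_adjoin (y : ExteriorAlgebra k (ℕ →₀ k)) :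
    fromExterior k y ∈ Algebra.adjoin k
      (Set.range fun i : ℕ => primeClass k (primeEquiv i)) := by
  induction y using ExteriorAlgebra.induction with
  | algebraMap r =>
    rw [AlgHom.commutes]
    exact Subalgebra.algebraMap_mem _ r
  | ι v =>
    induction v using Finsupp.induction_linear with
    | zero =>
      rw [map_zero, map_zero]
      exact Subalgebra.zero_mem _
    | add u v hu hv =>
      rw [map_add, map_add]
      exact Subalgebra.add_mem _ hu hv
    | single i c =>
      rw [← mul_one c, ← smul_eq_mul, ← Finsupp.smul_single, map_smul, map_smul, fromExterior_ι]
      have hi : primeClass k (primeEquiv i) ∈ Algebra.adjoin k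
          (Set.range fun i : ℕ => primeClass k (primeEquiv i)) := Algebra.subset_adjoin ⟨i, rfl⟩
      exact Subalgebra.smul_mem _ hi c
  | mul a b ha hb =>
    rw [map_mul]
    exact Subalgebra.mul_mem _ ha hb
  | add a b ha hb =>
    rw [map_add]
    exact Subalgebra.add_mem _ ha hb

end Injectivity

/-- Generators anticommute; one moves a generator past `y` by induction on the degree of `y`, then
the factors of `x` one at a time. -/
theorem exteriorPower_mul_comm {R M : Type*} [CommRing R] [AddCommGroup M] [Module R M] {p q : ℕ}
    {x y : ExteriorAlgebra R M} (hx : x ∈ ⋀[R]^p M) (hy : y ∈ ⋀[R]^q M) :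
    x * y = (-1 : R) ^ (p * q) • (y * x) := by
  have h1 : ∀ (m : M) (q : ℕ) (y : ExteriorAlgebra R M), y ∈ ⋀[R]^q M →
      ExteriorAlgebra.ι R m * y = (-1 : R) ^ q • (y * ExteriorAlgebra.ι R m) := by
    intro m q y hy
    induction hy using Submodule.pow_induction_on_left' with
    | algebraMap r => simp [Algebra.commutes]
    | add x y i _ _ hx hy => rw [mul_add, hx, hy, add_mul, smul_add]
    | mem_mul u hu i x _ ih =>
      obtain ⟨l, rfl⟩ := hu
      rw [← mul_assoc, eq_neg_of_add_eq_zero_left (ExteriorAlgebra.ι_add_mul_swap m l), neg_mul,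
        mul_assoc, ih, mul_smul_comm, ← mul_assoc, pow_succ, mul_neg_one, neg_smul]
  induction hx using Submodule.pow_induction_on_left' with
  | algebraMap r => simp [Algebra.commutes]
  | add x z i _ _ hx hz => rw [add_mul, hx, hz, mul_add, smul_add]
  | mem_mul u hu i x _ ih =>
    obtain ⟨l, rfl⟩ := hu
    rw [mul_assoc, ih, mul_smul_comm, ← mul_assoc, h1 l q y hy, smul_mul_assoc, smul_smul,
      ← pow_add, mul_assoc, Nat.succ_mul]

end Dirichlet

theorem mainTheorem2 (k : Type*) [Field k] [CharZero k] [TopologicalSpace k]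
    [DiscreteTopology k] :
    (∀ (p q : ℕ) (x : ContHochschild.HH (Dirichlet.augmentation k) p)
        (y : ContHochschild.HH (Dirichlet.augmentation k) q),
      (DirectSum.of _ p x * DirectSum.of _ q y :
          ContHochschild.HHAlgebra (Dirichlet.augmentation k)) =
        (-1 : k) ^ (p * q) • (DirectSum.of _ q y * DirectSum.of _ p x)) ∧
    ∃ X : ℕ → ContHochschild.HH (Dirichlet.augmentation k) 1,
      Algebra.adjoin k (Set.range fun i : ℕ =>
        (DirectSum.of _ 1 (X i) : ContHochschild.HHAlgebra (Dirichlet.augmentation k))) = ⊤ ∧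
      ∃ e : ContHochschild.HHAlgebra (Dirichlet.augmentation k) ≃ₐ[k]
          ExteriorAlgebra k (ℕ →₀ k),
        (∀ i : ℕ, e (DirectSum.of _ 1 (X i)) = ExteriorAlgebra.ι k (Finsupp.single i 1)) ∧
        ∀ (n : ℕ) (x : ContHochschild.HH (Dirichlet.augmentation k) n),
          e (DirectSum.of _ n x) ∈ ⋀[k]^n (ℕ →₀ k) := by
  have hmem : ∀ (n : ℕ) (x : ContHochschild.HH (Dirichlet.augmentation k) n),
      ∃ y ∈ ⋀[k]^n (ℕ →₀ k), Dirichlet.fromExterior k y = DirectSum.of _ n x := by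
    intro n x
    obtain ⟨z, rfl⟩ := ContHochschild.cls_surjective _ n x
    exact Dirichlet.exists_fromExterior_eq n z
  have hbij : Function.Bijective (Dirichlet.fromExterior k) :=
    ⟨Dirichlet.fromExterior_injective, Dirichlet.fromExterior_surjective⟩
  refine ⟨fun p q x y => ?_, fun i => ContHochschild.cls _ 1
    (Dirichlet.primeCocycle k (Dirichlet.primeEquiv i)), ?_,
    (AlgEquiv.ofBijective (Dirichlet.fromExterior k) hbij).symm, fun i => ?_, fun n x => ?_⟩
  -- Graded commutativity is carried over from the exterior algebra through homogeneous preimages.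
  · obtain ⟨u, hu, hu'⟩ := hmem p x
    obtain ⟨v, hv, hv'⟩ := hmem q y
    rw [← hu', ← hv', ← map_mul, ← map_mul, Dirichlet.exteriorPower_mul_comm hu hv]
    exact map_smul (Dirichlet.fromExterior k) _ _
  · refine eq_top_iff.2 fun x _ => ?_
    obtain ⟨y, rfl⟩ := Dirichlet.fromExterior_surjective x
    exact Dirichlet.fromExterior_mem_adjoin y
  · rw [AlgEquiv.symm_apply_eq]
    exact (Dirichlet.fromExterior_ι k i).symm
  · obtain ⟨y, hy, hy'⟩ := hmem n x
    rw [← hy']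
    have h := (AlgEquiv.ofBijective (Dirichlet.fromExterior k) hbij).symm_apply_apply y
    rw [AlgEquiv.ofBijective_apply] at h
    rwa [h]
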